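/- Let $n\ge 1$ and let $X=(X_{ij})_{1\le i,j\le n}$ be jointly gaussian real random variables with mean zero and $n^2\times n^2$ covariance matrix $\Sigma$ (no symmetry of $X$ is assumed, and $\Sigma$ may be singular). Let $A=n^{-1/2}(X_{ij})_{1\le i,j\le n}$. Let $f(z)=\sum_{m\ge 0}b_mz^m$ be an entire function on $\mathbb{C}$, with $b_m\in\mathbb{C}$, let $f(A)=\sum_{m\ge0} b_mA^m$, and put \[ f_1(x)=\sum_{m=1}^\infty m|b_m|x^{m-1},\qquad f_2(x)=\sum_{m=2}^\infty m(m-1)|b_m|x^{m-2}. \] Let $\lambda=\|A\|$, where $\|\cdot\|$ denotes the operator norm of a matrix with respect to the Euclidean norm, and let $a=(\mathbb{E}f_1(\lambda)^4)^{1/4}$ and $b=(\mathbb{E}f_2(\lambda)^4)^{1/4}$, both in $[0,\infty]$. Suppose that $W=\operatorname{Re}\operatorname{Tr}f(A)$ has finite fourth moment, and let $\sigma^2=\mathrm{Var}(W)$. Let $Z$ be a normal random variable with the same mean and variance as $W$. Then \[ d_{TV}(W,Z)\le \frac{2\sqrt5\,\|\Sigma\|^{3/2}\,ab}{\sigma^2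 n}, \] where $d_{TV}(W,Z)=\sup_B|\mathbb{P}(W\in B)-\mathbb{P}(Z\in B)|$ is the supremum over all Borel sets $B\subseteq\mathbb{R}$. (Both sides are read in $[0,\infty]$, with $0\cdot\infty=0$, $0/0=0$ and $x/0=\infty$ for $x>0$; in the degenerate case $\sigma^2=0$, the left-hand side is $0$.) -/

import Mathlib

open MeasureTheory ProbabilityTheory
open scoped ENNReal Nat

noncomputable section

/-- The `m`-th coefficient `b_m` in the expansion `f z = ∑ b_m z ^ m` at the origin. -/
def taylorCoeff (f : ℂ → ℂ) (m : ℕ) : ℂ :=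
  (m ! : ℂ)⁻¹ * iteratedDeriv m f 0

/-- For entire `f`, the coefficients are those of an everywhere convergent expansion of `f`. -/
theorem hasSum_taylorCoeff {f : ℂ → ℂ} (hf : Differentiable ℂ f) (z : ℂ) :
    HasSum (fun m => taylorCoeff f m * z ^ m) (f z) := by
  have h := Complex.hasSum_taylorSeries_of_entire hf 0 z
  have e : (fun m : ℕ => (m ! : ℂ)⁻¹ • (z - 0) ^ m • iteratedDeriv m f 0) =
      fun m => taylorCoeff f m * z ^ m := by
    funext m
    simp only [taylorCoeff, smul_eq_mul, sub_zero]
    ring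
  rwa [e] at h

/-- `f A = ∑ b_m A ^ m` for a square complex matrix `A`. -/
def matrixFun (f : ℂ → ℂ) {n : ℕ} (A : Matrix (Fin n) (Fin n) ℂ) : Matrix (Fin n) (Fin n) ℂ :=
  ∑' m : ℕ, taylorCoeff f m • A ^ m

/-- `f₁ x = ∑_{m ≥ 1} m |b_m| x ^ (m - 1)`, for real `x`, indexed by `k = m - 1`. -/
def majorantOne (f : ℂ → ℂ) (x : ℝ) : ℝ :=
  ∑' k : ℕ, ((k : ℝ) + 1) * ‖taylorCoeff f (k + 1)‖ * x ^ k

/-- `f₂ x = ∑_{m ≥ 2} m (m - 1) |b_m| x ^ (m - 2)`, for real `x`, indexed by `k = m - 2`. -/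
def majorantTwo (f : ℂ → ℂ) (x : ℝ) : ℝ :=
  ∑' k : ℕ, ((k : ℝ) + 2) * ((k : ℝ) + 1) * ‖taylorCoeff f (k + 2)‖ * x ^ k

/-- The operator norm of a square matrix with respect to the Euclidean norm. -/
def opNorm {ι 𝕜 : Type*} [Fintype ι] [DecidableEq ι] [RCLike 𝕜] (A : Matrix ι ι 𝕜) : ℝ :=
  ‖Matrix.toEuclideanCLM (n := ι) (𝕜 := 𝕜) A‖

/-- The matrix `n ^ (-1/2) (x_ij)`, as a complex matrix. -/
def scaledMatrix {n : ℕ} (x : Fin n → Fin n → ℝ) : Matrix (Fin n) (Fin n) ℂ :=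
  Matrix.of fun i j => (((n : ℝ) ^ (-(1 / 2) : ℝ) * x i j : ℝ) : ℂ)

/-- The total variation distance `sup_B |μ B - ν B|` over measurable sets `B`. -/
def tvDist {E : Type*} [MeasurableSpace E] (μ ν : Measure E) : ℝ≥0∞ :=
  ⨆ (B : Set E) (_ : MeasurableSet B), ENNReal.ofReal |μ.real B - ν.real B|

end

/-! Let `μ` be the law of the entries, `x`, `y` independent with law `μ`, and `x_t = cos t x + sin t
y`. Rotation invariance of `μ × μ` yields Gaussian integration by parts (`integral_mul_dual_eq`),
and from it `d/dt E g(x_t) F(x) = -sin t E⟨∇g(x_t), ∇F(x)⟩` in the covariance inner product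
(`hasDerivAt_integral_rotPoint_mul`). The correlation runs from `E gF` at `t = 0` to `E g E F` at `t
= π/2`, so `Cov(g, F)` is an average, with weight `sin t` of total mass one, of `E⟨∇g(x_t), ∇F(x)⟩`.

Taking `F = g` gives the Poincaré inequality. Taking `F = ψ ∘ g` gives an average of `E ψ'(g) U_t`,
where `U_t = ⟨∇g(x), ∇g(x_t)⟩`. Replacing `U_t` by its mean produces `E ψ'(g) Var g`, with an error
of at most `sup |ψ'|` times the standard deviation of `U_t`. Poincaré on the product space bounds
that deviation by fourth moments of the gradient and Hessian of `g`
(`gaussian_second_order_poincare`). Stein's equation has solutions with `|ψ'| ≤ 2 / σ²`, so the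
approximate Stein identity becomes a total variation bound (`tvDist_gaussianReal_le`). The constant
obtained is `4`, below `2√5`.

For `g = Re Tr f(A)` the gradient is at most `f₁(λ)` and the Hessian at most `f₂(λ) / n`: powers of
`A` are measured in operator norm, directions in Frobenius norm, and each direction carries a factor
`n ^ (-1/2)`. This is carried out for Taylor polynomials of `f`, where polynomial growth settles all
integrability, and passes to the limit by dominated convergence (`traceStat_approx_stein`). -/

/-! ### Polynomial growth -/

section PolyBound

variable {ι ι' V V' V'' : Type*} [SeminormedAddCommGroup V] [SeminormedAddCommGroup V']
  [SeminormedAddCommGroup V'']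

/-- `F` is bounded by a polynomial in the norm of `r`. -/
def PolyBound (r : ι → V) (F : ι → V') : Prop :=
  ∃ (K : ℝ) (N : ℕ), ∀ i, ‖F i‖ ≤ K * (1 + ‖r i‖) ^ N

namespace PolyBound

variable {r : ι → V} {F : ι → V'} {G : ι → V''}

theorem exists_nonneg (hF : PolyBound r F) :
    ∃ (K : ℝ) (N : ℕ), 0 ≤ K ∧ ∀ i, ‖F i‖ ≤ K * (1 + ‖r i‖) ^ N := by
  obtain ⟨K, N, h⟩ := hF
  refine ⟨|K|, N, abs_nonneg _, fun i => (h i).trans ?_⟩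
  gcongr
  exact le_abs_self K

theorem of_le (hF : PolyBound r F) (h : ∀ i, ‖G i‖ ≤ ‖F i‖) : PolyBound r G := by
  obtain ⟨K, N, hK⟩ := hF
  exact ⟨K, N, fun i => (h i).trans (hK i)⟩

theorem const (c : V') : PolyBound r (fun _ => c) := ⟨‖c‖, 0, fun i => by simp⟩

theorem self (r : ι → V) : PolyBound r r :=
  ⟨1, 1, fun i => by simp⟩

theorem norm (hF : PolyBound r F) : PolyBound r (fun i => ‖F i‖) :=
  hF.of_le fun i => by simp

theorem comp (hF : PolyBound r F) (T : ι' → ι) :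
    PolyBound (fun i => r (T i)) (fun i => F (T i)) := by
  obtain ⟨K, N, hK⟩ := hF
  exact ⟨K, N, fun i => hK _⟩

theorem add (hF : PolyBound r F) {G : ι → V'} (hG : PolyBound r G) :
    PolyBound r (fun i => F i + G i) := by
  obtain ⟨K, N, hK0, hK⟩ := hF.exists_nonneg
  obtain ⟨L, M, hL0, hL⟩ := hG.exists_nonneg
  refine ⟨K + L, N + M, fun i => (norm_add_le _ _).trans ?_⟩
  have h1 : (1 : ℝ) ≤ 1 + ‖r i‖ := by simp
  calc ‖F i‖ + ‖G i‖ ≤ K * (1 + ‖r i‖) ^ N + L * (1 + ‖r i‖) ^ M := add_le_add (hK i) (hL i)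
    _ ≤ K * (1 + ‖r i‖) ^ (N + M) + L * (1 + ‖r i‖) ^ (N + M) := by
        gcongr <;> first | exact h1 | omega
    _ = _ := by ring

theorem mul {F G : ι → ℝ} (hF : PolyBound r F) (hG : PolyBound r G) :
    PolyBound r (fun i => F i * G i) := by
  obtain ⟨K, N, hK0, hK⟩ := hF.exists_nonneg
  obtain ⟨L, M, hL0, hL⟩ := hG.exists_nonneg
  refine ⟨K * L, N + M, fun i => ?_⟩
  rw [norm_mul]
  calc ‖F i‖ * ‖G i‖ ≤ (K * (1 + ‖r i‖) ^ N) * (L * (1 + ‖r i‖) ^ M) := by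
        gcongr <;> first | exact hK i | exact hL i
    _ = _ := by ring

theorem pow {F : ι → ℝ} (hF : PolyBound r F) (k : ℕ) : PolyBound r (fun i => F i ^ k) := by
  induction k with
  | zero => simpa using PolyBound.const (r := r) (1 : ℝ)
  | succ k ih => simpa [pow_succ] using ih.mul hF

theorem trans {r' : ι → V'} {F : ι → V''} (hF : PolyBound r' F) (hr : PolyBound r r') :
    PolyBound r F := by
  obtain ⟨K, N, hK0, hK⟩ := hF.exists_nonneg
  have h2 : PolyBound r (fun i => K * (1 + ‖r' i‖) ^ N) :=
    (PolyBound.const K).mul (((PolyBound.const (1 : ℝ)).add hr.norm).pow N)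
  refine h2.of_le fun i => (hK i).trans (le_abs_self _)

theorem of_mul_le {W : Type*} [SeminormedAddCommGroup W] {H : ι → W} (hF : PolyBound r F)
    (hG : PolyBound r G)
    (h : ∀ i, ‖H i‖ ≤ ‖F i‖ * ‖G i‖) : PolyBound r H :=
  (hF.norm.mul hG.norm).of_le fun i => (h i).trans (le_abs_self _)

theorem clm_apply {E F' : Type*} [SeminormedAddCommGroup E] [NormedSpace ℝ E]
    [SeminormedAddCommGroup F'] [NormedSpace ℝ F'] {F : ι → E →L[ℝ] F'} {G : ι → E}
    (hF : PolyBound r F) (hG : PolyBound r G) : PolyBound r (fun i => F i (G i)) :=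
  hF.of_mul_le hG fun i => (F i).le_opNorm (G i)

end PolyBound

end PolyBound

/-! ### Gaussian moments and differentiation under the integral -/

section Moments

variable {E V : Type*} [NormedAddCommGroup E] [NormedSpace ℝ E] [MeasurableSpace E] [BorelSpace E]
  [CompleteSpace E] [SecondCountableTopology E] [NormedAddCommGroup V]

/-- Gaussian measures have all finite moments, and an `N`-th power is in `L^p` once its base is in
`L^(Np)`. -/
theorem memLp_one_add_norm_pow (μ : Measure E) [IsGaussian μ] (N : ℕ) {p : ℝ≥0∞} (hp : p ≠ ∞) :
    MemLp (fun x : E => (1 + ‖x‖) ^ N) p μ := by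
  have h1 : MemLp (fun x : E => 1 + ‖x‖) (N * p) μ := by
    have h0 : MemLp (fun x : E => x) (N * p) μ := IsGaussian.memLp_id μ (N * p)
      (ENNReal.mul_ne_top (ENNReal.natCast_ne_top N) hp)
    exact (memLp_const (1 : ℝ)).add h0.norm
  -- The exponent is recovered as `N * p / N`, which needs `N ≠ 0`.
  rcases Nat.eq_zero_or_pos N with hN | hN
  · simp only [hN, pow_zero]
    exact memLp_const (1 : ℝ)
  have h4 : (N * p) / (N : ℝ≥0∞) = p := by
    rw [mul_comm, mul_div_assoc, ENNReal.div_self (by exact_mod_cast hN.ne')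
      (ENNReal.natCast_ne_top N), mul_one]
  have h3 : MemLp (fun x : E => ‖1 + ‖x‖‖ ^ (N : ℝ≥0∞).toReal) (N * p / N) μ :=
    h1.norm_rpow_div (N : ℝ≥0∞)
  rw [h4] at h3
  refine h3.congr_norm (by fun_prop) (Filter.Eventually.of_forall fun x => ?_)
  rw [ENNReal.toReal_natCast, Real.rpow_natCast, norm_pow, norm_pow, norm_norm]

theorem PolyBound.memLp {F : E → V} (hF : PolyBound id F) (μ : Measure E) [IsGaussian μ]
    (hm : AEStronglyMeasurable F μ) {p : ℝ≥0∞} (hp : p ≠ ∞) : MemLp F p μ := by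
  obtain ⟨K, N, h⟩ := hF
  exact ((memLp_one_add_norm_pow μ N hp).const_mul K).of_le hm
    (Filter.Eventually.of_forall fun x => (h x).trans (le_abs_self _))

theorem PolyBound.integrable {F : E → V} (hF : PolyBound id F) (μ : Measure E) [IsGaussian μ]
    (hm : AEStronglyMeasurable F μ) : Integrable F μ :=
  memLp_one_iff_integrable.1 (hF.memLp μ hm (by simp))

/-- The growth bound refers only to the space variable, hence is uniform in `t`, and a single
integrable function dominates the derivative for all `t`. -/
theorem hasDerivAt_integral_of_polyBound (μ : Measure E) [IsGaussian μ] {Q Q' : ℝ → E → ℝ}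
    (hd : ∀ t z, HasDerivAt (Q · z) (Q' t z) t) (hc : ∀ t, Continuous (Q t))
    (hc' : ∀ t, Continuous (Q' t))
    (hp : PolyBound (fun p : ℝ × E => p.2) (fun p => Q p.1 p.2))
    (hp' : PolyBound (fun p : ℝ × E => p.2) (fun p => Q' p.1 p.2)) (t : ℝ) :
    HasDerivAt (fun t => ∫ z, Q t z ∂μ) (∫ z, Q' t z ∂μ) t := by
  obtain ⟨K, N, h⟩ := hp'
  have hb : PolyBound (id : E → E) (fun z => K * (1 + ‖z‖) ^ N) :=
    (PolyBound.const K).mul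
      (((PolyBound.const (1 : ℝ)).add (PolyBound.self id).norm).pow N)
  exact (hasDerivAt_integral_of_dominated_loc_of_deriv_le (s := Set.univ) Filter.univ_mem
    (Filter.Eventually.of_forall fun t => (hc t).aestronglyMeasurable)
    ((hp.comp (fun z => (t, z))).integrable μ (hc t).aestronglyMeasurable)
    (hc' t).aestronglyMeasurable
    (Filter.Eventually.of_forall fun z s _ => h (s, z))
    (hb.integrable μ (by fun_prop))
    (Filter.Eventually.of_forall fun z s _ => hd s z)).2

end Moments

/-! ### Rotations and Gaussian integration by parts -/

section GaussianCalculus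

variable {E V : Type*} [NormedAddCommGroup E] [NormedSpace ℝ E] [NormedAddCommGroup V]
  [NormedSpace ℝ V]

/-- `g` has the continuous derivative `g'`, and both have polynomial growth. -/
structure HasTameFDeriv (g : E → V) (g' : E → E →L[ℝ] V) : Prop where
  hasFDerivAt : ∀ x, HasFDerivAt g (g' x) x
  continuous_fderiv : Continuous g'
  polyBound : PolyBound id g
  polyBound_fderiv : PolyBound id g'

theorem HasTameFDeriv.continuous {g : E → V} {g' : E → E →L[ℝ] V} (h : HasTameFDeriv g g') :
    Continuous g :=
  continuous_iff_continuousAt.2 fun x => (h.hasFDerivAt x).continuousAt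

/-- The point of the circle through `z.1` and `z.2` at angle `t`. -/
noncomputable def rotPoint (t : ℝ) (z : E × E) : E := Real.cos t • z.1 + Real.sin t • z.2

/-- The velocity of `rotPoint` at angle `t`. -/
noncomputable def rotVel (t : ℝ) (z : E × E) : E := -Real.sin t • z.1 + Real.cos t • z.2

theorem continuous_rotPoint (t : ℝ) : Continuous (rotPoint (E := E) t) := by
  unfold rotPoint; fun_prop

theorem continuous_rotVel (t : ℝ) : Continuous (rotVel (E := E) t) := by
  unfold rotVel; fun_prop

theorem hasDerivAt_rotPoint (t : ℝ) (z : E × E) :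
    HasDerivAt (rotPoint · z) (rotVel t z) t :=
  ((Real.hasDerivAt_cos t).smul_const z.1).add ((Real.hasDerivAt_sin t).smul_const z.2)

theorem hasDerivAt_rotVel (t : ℝ) (z : E × E) :
    HasDerivAt (rotVel · z) (-rotPoint t z) t := by
  have h : -rotPoint t z = -Real.cos t • z.1 + -Real.sin t • z.2 := by
    unfold rotPoint; module
  rw [h]
  exact ((Real.hasDerivAt_sin t).neg.smul_const z.1).add ((Real.hasDerivAt_cos t).smul_const z.2)

theorem norm_smul_add_smul_le {a b : ℝ} (ha : |a| ≤ 1) (hb : |b| ≤ 1) (x y : E) :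
    ‖a • x + b • y‖ ≤ ‖x‖ + ‖y‖ := by
  refine (norm_add_le _ _).trans ?_
  rw [norm_smul, norm_smul]
  exact add_le_add (mul_le_of_le_one_left (norm_nonneg _) ha)
    (mul_le_of_le_one_left (norm_nonneg _) hb)

theorem norm_rotPoint_le (t : ℝ) (z : E × E) : ‖rotPoint t z‖ ≤ ‖z.1‖ + ‖z.2‖ :=
  norm_smul_add_smul_le (Real.abs_cos_le_one t) (Real.abs_sin_le_one t) _ _

theorem norm_rotVel_le (t : ℝ) (z : E × E) : ‖rotVel t z‖ ≤ ‖z.1‖ + ‖z.2‖ :=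
  norm_smul_add_smul_le (by simpa using Real.abs_sin_le_one t) (Real.abs_cos_le_one t) _ _

omit [NormedSpace ℝ E] in
theorem polyBound_fst {ι : Type*} (T : ι → E × E) : PolyBound T (fun i => (T i).1) :=
  (PolyBound.self T).of_le fun _ => norm_fst_le _

omit [NormedSpace ℝ E] in
theorem polyBound_snd {ι : Type*} (T : ι → E × E) : PolyBound T (fun i => (T i).2) :=
  (PolyBound.self T).of_le fun _ => norm_snd_le _

theorem polyBound_rotPoint {ι : Type*} (s : ι → ℝ) (T : ι → E × E) :
    PolyBound T (fun i => rotPoint (s i) (T i)) :=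
  ((polyBound_fst T).norm.add (polyBound_snd T).norm).of_le fun _ =>
    (norm_rotPoint_le _ _).trans (le_abs_self _)

theorem polyBound_rotVel {ι : Type*} (s : ι → ℝ) (T : ι → E × E) :
    PolyBound T (fun i => rotVel (s i) (T i)) :=
  ((polyBound_fst T).norm.add (polyBound_snd T).norm).of_le fun _ =>
    (norm_rotVel_le _ _).trans (le_abs_self _)

/-- The inverse rotation; it rewrites a function of the starting point in terms of the rotated pair.
-/
theorem rotPoint_neg_rotate (t : ℝ) (z : E × E) :
    Real.cos t • rotPoint t z - Real.sin t • rotVel t z = z.1 := by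
  have h := Real.cos_sq_add_sin_sq t
  have h2 : Real.cos t • rotPoint t z - Real.sin t • rotVel t z
      = (Real.cos t ^ 2 + Real.sin t ^ 2) • z.1 := by
    unfold rotPoint rotVel; module
  rw [h2, h, one_smul]

variable [MeasurableSpace E] [BorelSpace E] [CompleteSpace E] [SecondCountableTopology E]
  {μ : Measure E} [IsGaussian μ]

/-- The square of a centred Gaussian measure is rotation invariant, so position and velocity at any
angle are again independent with law `μ`. -/
theorem integral_rotate (hμ : μ[id] = 0) (t : ℝ) {Φ : E × E → ℝ} (hΦ : Continuous Φ) :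
    ∫ z, Φ (rotPoint t z, rotVel t z) ∂μ.prod μ = ∫ z, Φ z ∂μ.prod μ := by
  conv_rhs => rw [← IsGaussian.map_rotation_eq_self hμ t]
  rw [integral_map (by fun_prop) hΦ.aestronglyMeasurable]
  rfl

theorem integral_rotPoint (hμ : μ[id] = 0) (t : ℝ) {F : E → ℝ} (hF : Continuous F) :
    ∫ z, F (rotPoint t z) ∂μ.prod μ = ∫ x, F x ∂μ := by
  rw [integral_rotate hμ t (Φ := fun z => F z.1) (by fun_prop), integral_fun_fst]
  simp

theorem uncenteredCovarianceBilinDual_eq (μ : Measure E) [IsGaussian μ] (l m : StrongDual ℝ E) :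
    uncenteredCovarianceBilinDual μ l m = ∫ x, l x * m x ∂μ :=
  uncenteredCovarianceBilinDual_apply IsGaussian.memLp_two_id l m

omit [NormedSpace ℝ V] [CompleteSpace E] [SecondCountableTopology E] [IsGaussian μ] in
theorem polyBound_bilin {ι : Type*} {r : ι → V} {l m : ι → StrongDual ℝ E}
    (hl : PolyBound r l) (hm : PolyBound r m) :
    PolyBound r (fun i => uncenteredCovarianceBilinDual μ (l i) (m i)) := by
  refine ((hl.norm.mul hm.norm).mul (PolyBound.const (∫ x, ‖x‖ ^ 2 ∂μ))).of_le fun i => ?_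
  exact (norm_uncenteredCovarianceBilinDual_le (l i) (m i)).trans (le_abs_self _)

/-- Gaussian integration by parts against a continuous linear functional. -/
theorem integral_mul_dual_eq (hμ : μ[id] = 0) {k : E → ℝ} {k' : E → StrongDual ℝ E}
    (hk : HasTameFDeriv k k') (l : StrongDual ℝ E) :
    ∫ x, k x * l x ∂μ = ∫ x, uncenteredCovarianceBilinDual μ (k' x) l ∂μ := by
  have hkc := hk.continuous
  have hk'c := hk.continuous_fderiv
  -- The integral of `Q t` does not depend on `t`. Its derivative vanishes, and at `t = 0`, where
  -- the velocity is `z.2` and the acceleration is `-z.1`, this is the claimed identity once `z.2`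
  -- is integrated out.
  set Q : ℝ → E × E → ℝ := fun t z => k (rotPoint t z) * l (rotVel t z) with hQ
  set Q' : ℝ → E × E → ℝ := fun t z =>
    k' (rotPoint t z) (rotVel t z) * l (rotVel t z) + k (rotPoint t z) * l (-rotPoint t z) with hQ'
  have hcP := continuous_rotPoint (E := E)
  have hcV := continuous_rotVel (E := E)
  have hbP : PolyBound (fun p : ℝ × (E × E) => p.2) (fun p => rotPoint p.1 p.2) :=
    polyBound_rotPoint _ _
  have hbV : PolyBound (fun p : ℝ × (E × E) => p.2) (fun p => rotVel p.1 p.2) :=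
    polyBound_rotVel _ _
  have hbk : PolyBound (fun p : ℝ × (E × E) => p.2) (fun p => k (rotPoint p.1 p.2)) :=
    (hk.polyBound.comp fun p : ℝ × (E × E) => rotPoint p.1 p.2).trans hbP
  have hbk' : PolyBound (fun p : ℝ × (E × E) => p.2) (fun p => k' (rotPoint p.1 p.2)) :=
    (hk.polyBound_fderiv.comp fun p : ℝ × (E × E) => rotPoint p.1 p.2).trans hbP
  have hbl : PolyBound (fun p : ℝ × (E × E) => p.2) (fun p => l (rotVel p.1 p.2)) :=
    (PolyBound.const l).clm_apply hbV
  have hbl2 : PolyBound (fun p : ℝ × (E × E) => p.2) (fun p => l (-rotPoint p.1 p.2)) :=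
    (PolyBound.const l).clm_apply (hbP.of_le fun i => by simp)
  have hd : HasDerivAt (fun t => ∫ z, Q t z ∂μ.prod μ) (∫ z, Q' 0 z ∂μ.prod μ) 0 := by
    refine hasDerivAt_integral_of_polyBound (μ.prod μ) (fun t z => ?_) (fun t => ?_) (fun t => ?_)
      (hbk.mul hbl) (((hbk'.clm_apply hbV).mul hbl).add (hbk.mul hbl2)) 0
    · exact ((hk.hasFDerivAt _).comp_hasDerivAt t (hasDerivAt_rotPoint t z)).mul
        (l.hasFDerivAt.comp_hasDerivAt t (hasDerivAt_rotVel t z))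
    · have := hcP t; have := hcV t; fun_prop
    · have := hcP t; have := hcV t; fun_prop
  have hconst : (fun t => ∫ z, Q t z ∂μ.prod μ) = fun _ => ∫ z, k z.1 * l z.2 ∂μ.prod μ := by
    funext t
    exact integral_rotate hμ t (Φ := fun z => k z.1 * l z.2) (by fun_prop)
  rw [hconst] at hd
  have h0 : ∫ z, Q' 0 z ∂μ.prod μ = 0 := hd.unique (hasDerivAt_const 0 _)
  have hQ0 : ∀ z : E × E, Q' 0 z = k' z.1 z.2 * l z.2 - k z.1 * l z.1 := fun z => by
    simp [hQ', rotPoint, rotVel]; ring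
  have hi1 : Integrable (fun z : E × E => k' z.1 z.2 * l z.2) (μ.prod μ) := by
    refine PolyBound.integrable ?_ _ (by fun_prop)
    exact (((hk.polyBound_fderiv.comp Prod.fst).trans (polyBound_fst id)).clm_apply
      (polyBound_snd id)).mul ((PolyBound.const l).clm_apply (polyBound_snd id))
  have hi2 : Integrable (fun z : E × E => k z.1 * l z.1) (μ.prod μ) := by
    refine PolyBound.integrable ?_ _ (by fun_prop)
    exact ((hk.polyBound.comp Prod.fst).trans (polyBound_fst id)).mul
      ((PolyBound.const l).clm_apply (polyBound_fst id))
  simp_rw [hQ0] at h0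
  rw [integral_sub hi1 hi2, sub_eq_zero, integral_prod _ hi1,
    integral_fun_fst (fun x => k x * l x)] at h0
  simp only [probReal_univ, one_smul] at h0
  rw [← h0]
  exact integral_congr_ae (Filter.Eventually.of_forall fun x =>
    (uncenteredCovarianceBilinDual_eq μ (k' x) l).symm)

/-- Derivative of the correlation between `g` along the rotation and `F` at its origin. -/
theorem hasDerivAt_integral_rotPoint_mul (hμ : μ[id] = 0) {g F : E → ℝ} {g' F' : E → StrongDual ℝ E}
    (hg : HasTameFDeriv g g') (hF : HasTameFDeriv F F') (t : ℝ) :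
    HasDerivAt (fun t => ∫ z, g (rotPoint t z) * F z.1 ∂μ.prod μ)
      (-Real.sin t * ∫ z, uncenteredCovarianceBilinDual μ (g' (rotPoint t z)) (F' z.1) ∂μ.prod μ)
      t := by
  have hgc := hg.continuous
  have hg'c := hg.continuous_fderiv
  have hFc := hF.continuous
  have hF'c := hF.continuous_fderiv
  have hcP := continuous_rotPoint (E := E)
  have hcV := continuous_rotVel (E := E)
  have hbP : PolyBound (fun p : ℝ × (E × E) => p.2) (fun p => rotPoint p.1 p.2) :=
    polyBound_rotPoint _ _
  have hbV : PolyBound (fun p : ℝ × (E × E) => p.2) (fun p => rotVel p.1 p.2) :=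
    polyBound_rotVel _ _
  have hbF : PolyBound (fun p : ℝ × (E × E) => p.2) (fun p => F p.2.1) :=
    (hF.polyBound.comp fun p : ℝ × (E × E) => p.2.1).trans (polyBound_fst _)
  have hd : HasDerivAt (fun t => ∫ z, g (rotPoint t z) * F z.1 ∂μ.prod μ)
      (∫ z, g' (rotPoint t z) (rotVel t z) * F z.1 ∂μ.prod μ) t := by
    refine hasDerivAt_integral_of_polyBound (μ.prod μ)
      (Q' := fun t z => g' (rotPoint t z) (rotVel t z) * F z.1)
      (fun t z => ?_) (fun t => ?_) (fun t => ?_)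
      (((hg.polyBound.comp fun p : ℝ × (E × E) => rotPoint p.1 p.2).trans hbP).mul hbF)
      ((((hg.polyBound_fderiv.comp fun p : ℝ × (E × E) => rotPoint p.1 p.2).trans hbP).clm_apply
        hbV).mul hbF) t
    · exact ((hg.hasFDerivAt _).comp_hasDerivAt t (hasDerivAt_rotPoint t z)).mul_const _
    · have := hcP t; fun_prop
    · have := hcP t; have := hcV t; fun_prop
  convert hd using 1
  have hT : Continuous fun z : E × E => Real.cos t • z.1 - Real.sin t • z.2 := by fun_prop
  have hbT : PolyBound (id : E × E → E × E) (fun z => Real.cos t • z.1 - Real.sin t • z.2) :=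
    -- The inverse rotation is the rotation by `-t`.
    (polyBound_rotPoint (fun _ => -t) id).of_le fun z => by
      simp [rotPoint, sub_eq_add_neg]
  have hFT : PolyBound (id : E × E → E × E) (fun z => F (Real.cos t • z.1 - Real.sin t • z.2)) :=
    (hF.polyBound.comp _).trans hbT
  have hF'T : PolyBound (id : E × E → E × E)
      (fun z => F' (Real.cos t • z.1 - Real.sin t • z.2)) :=
    (hF.polyBound_fderiv.comp _).trans hbT
  have hbg' : PolyBound (id : E × E → E × E) (fun z => g' z.1) :=
    (hg.polyBound_fderiv.comp _).trans (polyBound_fst id)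
  -- In rotated coordinates the pair (position, velocity) becomes `(x, y)` and the starting point
  -- becomes `cos t x - sin t y`. Integration by parts in `y` with `x` frozen then applies, and the
  -- chain rule supplies the factor `-sin t`.
  have e1 := integral_rotate hμ t
    (Φ := fun z => g' z.1 z.2 * F (Real.cos t • z.1 - Real.sin t • z.2)) (by fun_prop)
  have e2 := integral_rotate hμ t (Φ := fun z => uncenteredCovarianceBilinDual μ (g' z.1)
    (F' (Real.cos t • z.1 - Real.sin t • z.2))) (by fun_prop)
  simp only [rotPoint_neg_rotate] at e1 e2
  rw [e1, e2, integral_prod, integral_prod, ← integral_const_mul]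
  · refine integral_congr_ae (Filter.Eventually.of_forall fun x => ?_)
    have hline : PolyBound (id : E → E) (fun y => (x, y)) :=
      ((PolyBound.const ‖x‖).add (PolyBound.self id).norm).of_le fun y => by
        simp only [Prod.norm_def, Real.norm_eq_abs, id]
        rw [abs_of_nonneg (by positivity)]
        exact max_le (by simp) (by simp)
    have hk : HasTameFDeriv (fun y => F (Real.cos t • x - Real.sin t • y))
        (fun y => (-Real.sin t) • F' (Real.cos t • x - Real.sin t • y)) := by
      refine ⟨fun y => ?_, by fun_prop, (hFT.comp fun y => (x, y)).trans hline, ?_⟩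
      · have h1 : HasFDerivAt (fun y : E => Real.cos t • x - Real.sin t • y)
            (-(Real.sin t • ContinuousLinearMap.id ℝ E)) y :=
          ((hasFDerivAt_id y).const_smul (Real.sin t)).const_sub _
        have h2 := (hF.hasFDerivAt (Real.cos t • x - Real.sin t • y)).comp y h1
        rw [ContinuousLinearMap.comp_neg, ContinuousLinearMap.comp_smul,
          ContinuousLinearMap.comp_id, ← neg_smul] at h2
        exact h2
      · refine (((hF'T.comp fun y => (x, y)).trans hline)).of_le fun y => ?_
        rw [norm_smul, norm_neg]
        exact mul_le_of_le_one_left (norm_nonneg _) (Real.abs_sin_le_one t)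
    have h := integral_mul_dual_eq hμ hk (g' x)
    simp only [mul_comm (g' x _)]
    rw [h, ← integral_const_mul]
    refine integral_congr_ae (Filter.Eventually.of_forall fun y => ?_)
    simp only [map_smul, smul_apply, smul_eq_mul]
    congr 1
    rw [uncenteredCovarianceBilinDual_eq, uncenteredCovarianceBilinDual_eq]
    simp only [mul_comm]
  · exact ((hbg'.clm_apply (polyBound_snd id)).mul hFT).integrable _ (by fun_prop)
  · exact (polyBound_bilin hbg' hF'T).integrable _ (by fun_prop)

end GaussianCalculus

/-! ### The Gaussian Poincaré inequality -/

section Poincare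

variable {E : Type*} [NormedAddCommGroup E] [NormedSpace ℝ E]
  [MeasurableSpace E] [BorelSpace E] [CompleteSpace E] [SecondCountableTopology E]
  {μ : Measure E} [IsGaussian μ]

theorem uncenteredCovarianceBilinDual_comm (l m : StrongDual ℝ E) :
    uncenteredCovarianceBilinDual μ l m = uncenteredCovarianceBilinDual μ m l := by
  simp only [uncenteredCovarianceBilinDual_eq, mul_comm]

theorem uncenteredCovarianceBilinDual_self_nonneg (l : StrongDual ℝ E) :
    0 ≤ uncenteredCovarianceBilinDual μ l l := by
  rw [uncenteredCovarianceBilinDual_eq]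
  exact integral_nonneg fun x => mul_self_nonneg _

/-- The quadratic form is nonnegative at `l - m` and at `l + m`. -/
theorem two_mul_abs_uncenteredCovarianceBilinDual_le (l m : StrongDual ℝ E) :
    2 * |uncenteredCovarianceBilinDual μ l m| ≤
      uncenteredCovarianceBilinDual μ l l + uncenteredCovarianceBilinDual μ m m := by
  have h1 := uncenteredCovarianceBilinDual_self_nonneg (μ := μ) (l - m)
  have h2 := uncenteredCovarianceBilinDual_self_nonneg (μ := μ) (l + m)
  have h3 := uncenteredCovarianceBilinDual_comm (μ := μ) l m
  simp only [map_sub, map_add, sub_apply, add_apply] at h1 h2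
  rcases abs_cases (uncenteredCovarianceBilinDual μ l m) with ⟨h, _⟩ | ⟨h, _⟩ <;>
    rw [h] <;> linarith

/-- The arithmetic-mean bound is applied to `‖m‖ • l` and `‖l‖ • m`, which have equal norms, and the
common factor is cancelled. -/
theorem abs_uncenteredCovarianceBilinDual_le {s : ℝ}
    (hs : ∀ l : StrongDual ℝ E, uncenteredCovarianceBilinDual μ l l ≤ s * ‖l‖ ^ 2)
    (l m : StrongDual ℝ E) :
    |uncenteredCovarianceBilinDual μ l m| ≤ s * (‖l‖ * ‖m‖) := by
  rcases eq_or_ne l 0 with rfl | hl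
  · simp
  rcases eq_or_ne m 0 with rfl | hm
  · simp
  have hl' := norm_pos_iff.2 hl
  have hm' := norm_pos_iff.2 hm
  have h := two_mul_abs_uncenteredCovarianceBilinDual_le (μ := μ) (‖m‖ • l) (‖l‖ • m)
  have h1 := hs l
  have h2 := hs m
  simp only [map_smul, smul_apply, smul_eq_mul, abs_mul, abs_norm] at h
  have h3 : 2 * (‖l‖ * ‖m‖) * |uncenteredCovarianceBilinDual μ l m|
      ≤ 2 * (‖l‖ * ‖m‖) * (s * (‖l‖ * ‖m‖)) := by
    have h4 := mul_le_mul_of_nonneg_left h1 (sq_nonneg ‖m‖)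
    have h5 := mul_le_mul_of_nonneg_left h2 (sq_nonneg ‖l‖)
    linarith
  exact le_of_mul_le_mul_left h3 (by positivity)

/-- A function on the quarter circle whose derivative is at most `M sin t` changes by at most
`M`. -/
theorem abs_sub_le_of_deriv_le_sin {D d : ℝ → ℝ} {M : ℝ} (hD : ∀ t, HasDerivAt D (d t) t)
    (hd : ∀ t, 0 ≤ Real.sin t → |d t| ≤ M * Real.sin t) :
    |D 0 - D (Real.pi / 2)| ≤ M := by
  -- The comparison function `M (1 - cos t)` has derivative `M sin t` and increases from `0` to `M`
  -- on the quarter circle.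
  have h := image_norm_le_of_norm_deriv_right_le_deriv_boundary (E := ℝ) (a := 0)
    (b := Real.pi / 2) (f := fun t => D t - D 0) (f' := d) (B := fun t => M * (1 - Real.cos t))
    (B' := fun t => M * Real.sin t)
    (fun t _ => ((hD t).sub_const _).continuousAt.continuousWithinAt)
    (fun t _ => ((hD t).sub_const _).hasDerivWithinAt) (by simp)
    (fun t => by simpa using ((Real.hasDerivAt_cos t).const_sub 1).const_mul M)
    (fun t ht => hd t (Real.sin_nonneg_of_nonneg_of_le_pi ht.1
      (ht.2.le.trans (by linarith [Real.pi_pos]))))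
    (x := Real.pi / 2) ⟨by positivity, le_rfl⟩
  rw [abs_sub_comm]
  simpa using h

theorem integrable_bilin_rotPoint {g F : E → ℝ} {g' F' : E → StrongDual ℝ E}
    (hg : HasTameFDeriv g g') (hF : HasTameFDeriv F F') (t : ℝ) :
    Integrable (fun z : E × E => uncenteredCovarianceBilinDual μ (g' (rotPoint t z)) (F' z.1))
      (μ.prod μ) := by
  have := continuous_rotPoint (E := E) t
  have := hg.continuous_fderiv
  have := hF.continuous_fderiv
  exact (polyBound_bilin ((hg.polyBound_fderiv.comp _).trans (polyBound_rotPoint (fun _ => t) id))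
    ((hF.polyBound_fderiv.comp _).trans (polyBound_fst id))).integrable _ (by fun_prop)

theorem integral_rotPoint_mul_zero {g F : E → ℝ} :
    ∫ z : E × E, g (rotPoint 0 z) * F z.1 ∂μ.prod μ = ∫ x, g x * F x ∂μ := by
  simp only [rotPoint, Real.cos_zero, Real.sin_zero, one_smul, zero_smul, add_zero]
  rw [integral_fun_fst (fun x => g x * F x)]
  simp

/-- At angle `π / 2` the rotated point is the independent copy, so the correlation factors. -/
theorem integral_rotPoint_mul_pi_div_two {g F : E → ℝ} :
    ∫ z : E × E, g (rotPoint (Real.pi / 2) z) * F z.1 ∂μ.prod μ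
      = (∫ x, g x ∂μ) * ∫ x, F x ∂μ := by
  simp only [rotPoint, Real.cos_pi_div_two, Real.sin_pi_div_two, one_smul, zero_smul, zero_add]
  rw [← integral_prod_mul, ← integral_prod_swap]
  simp only [Prod.fst_swap, Prod.snd_swap]

/-- The Gaussian Poincaré inequality. -/
theorem gaussian_poincare (hμ : μ[id] = 0) {g : E → ℝ} {g' : E → StrongDual ℝ E}
    (hg : HasTameFDeriv g g') :
    ∫ x, g x * g x ∂μ - (∫ x, g x ∂μ) * ∫ x, g x ∂μ
      ≤ ∫ x, uncenteredCovarianceBilinDual μ (g' x) (g' x) ∂μ := by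
  have hg'c := hg.continuous_fderiv
  set D := ∫ x, uncenteredCovarianceBilinDual μ (g' x) (g' x) ∂μ with hD
  -- The correlation of `g` with itself has derivative at most `D sin t` in size: the mixed inner
  -- product is at most the mean of two squares, and both points have law `μ`.
  have h := abs_sub_le_of_deriv_le_sin (M := D)
    (hasDerivAt_integral_rotPoint_mul hμ hg hg) fun t ht => by
      rw [abs_mul, abs_neg, abs_of_nonneg ht, mul_comm]
      refine mul_le_mul_of_nonneg_right ?_ ht
      have hB : PolyBound id fun x => uncenteredCovarianceBilinDual μ (g' x) (g' x) :=
        polyBound_bilin hg.polyBound_fderiv hg.polyBound_fderiv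
      have h1 : ∫ z : E × E, uncenteredCovarianceBilinDual μ (g' (rotPoint t z))
          (g' (rotPoint t z)) ∂μ.prod μ = D :=
        integral_rotPoint hμ t (F := fun x => uncenteredCovarianceBilinDual μ (g' x) (g' x))
          (by fun_prop)
      have h2 : ∫ z : E × E, uncenteredCovarianceBilinDual μ (g' z.1) (g' z.1) ∂μ.prod μ = D := by
        rw [integral_fun_fst (fun x => uncenteredCovarianceBilinDual μ (g' x) (g' x))]; simp [hD]
      have hc := continuous_rotPoint (E := E) t
      have i1 : Integrable (fun z : E × E => uncenteredCovarianceBilinDual μ (g' (rotPoint t z))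
          (g' (rotPoint t z))) (μ.prod μ) :=
        ((hB.comp _).trans (polyBound_rotPoint (fun _ => t) id)).integrable _ (by fun_prop)
      have i2 : Integrable (fun z : E × E => uncenteredCovarianceBilinDual μ (g' z.1) (g' z.1))
          (μ.prod μ) :=
        ((hB.comp _).trans (polyBound_fst id)).integrable _ (by fun_prop)
      calc |∫ z : E × E, uncenteredCovarianceBilinDual μ (g' (rotPoint t z)) (g' z.1) ∂μ.prod μ|
          ≤ ∫ z : E × E, |uncenteredCovarianceBilinDual μ (g' (rotPoint t z)) (g' z.1)| ∂μ.prod μ :=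
            abs_integral_le_integral_abs
        _ ≤ ∫ z : E × E, (uncenteredCovarianceBilinDual μ (g' (rotPoint t z)) (g' (rotPoint t z))
              + uncenteredCovarianceBilinDual μ (g' z.1) (g' z.1)) / 2 ∂μ.prod μ := by
            refine integral_mono (integrable_bilin_rotPoint hg hg t).abs ((i1.add i2).div_const 2)
              fun z => ?_
            have := two_mul_abs_uncenteredCovarianceBilinDual_le (μ := μ) (g' (rotPoint t z))
              (g' z.1)
            simp only
            linarith
        _ = D := by
            rw [integral_div, integral_add i1 i2, h1, h2]; ring
  rw [integral_rotPoint_mul_zero, integral_rotPoint_mul_pi_div_two] at h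
  exact (le_abs_self _).trans h

end Poincare

/-! ### The second order Poincaré inequality -/

section SecondOrder

variable {E : Type*} [NormedAddCommGroup E] [NormedSpace ℝ E]

theorem abs_le_of_hasDerivAt_of_abs_le {ψ ψ' : ℝ → ℝ} {M : ℝ}
    (hψ : ∀ x, HasDerivAt ψ (ψ' x) x) (hM : ∀ x, |ψ' x| ≤ M) (x : ℝ) :
    |ψ x| ≤ |ψ 0| + M * |x| := by
  have h := Convex.norm_image_sub_le_of_norm_hasDerivWithin_le (f := ψ) (f' := ψ') (C := M)
    (s := Set.univ) (x := 0) (y := x) (fun y _ => (hψ y).hasDerivWithinAt) (fun y _ => hM y)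
    convex_univ trivial trivial
  simp only [Real.norm_eq_abs, sub_zero] at h
  have := abs_sub_abs_le_abs_sub (ψ x) (ψ 0)
  linarith

theorem HasTameFDeriv.comp_of_deriv_bounded {g : E → ℝ} {g' : E → StrongDual ℝ E}
    (hg : HasTameFDeriv g g') {ψ ψ' : ℝ → ℝ} {M : ℝ} (hψ : ∀ x, HasDerivAt ψ (ψ' x) x)
    (hψ' : Continuous ψ') (hM : ∀ x, |ψ' x| ≤ M) :
    HasTameFDeriv (fun x => ψ (g x)) (fun x => ψ' (g x) • g' x) := by
  have := hg.continuous
  have := hg.continuous_fderiv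
  refine ⟨fun x => (hψ (g x)).comp_hasFDerivAt x (hg.hasFDerivAt x), by fun_prop, ?_, ?_⟩
  · refine (((PolyBound.const |ψ 0|).add ((PolyBound.const M).mul hg.polyBound.norm))).of_le
      fun x => ?_
    exact (abs_le_of_hasDerivAt_of_abs_le hψ hM (g x)).trans (le_abs_self _)
  · refine (PolyBound.const M).of_mul_le hg.polyBound_fderiv fun x => ?_
    rw [norm_smul]
    gcongr
    exact (hM _).trans (le_abs_self M)

variable [MeasurableSpace E] [BorelSpace E] [CompleteSpace E] [SecondCountableTopology E]
  {μ : Measure E} [IsGaussian μ]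

theorem integral_id_prod_self (hμ : μ[id] = 0) : (μ.prod μ)[id] = 0 := by
  have hi : Integrable (id : E × E → E × E) (μ.prod μ) := IsGaussian.integrable_id
  refine Prod.ext ?_ ?_
  · have h := (ContinuousLinearMap.fst ℝ E E).integral_comp_comm hi
    have h2 : ∫ z : E × E, z.1 ∂μ.prod μ = 0 := by
      rw [integral_fun_fst (fun x : E => x)]
      simpa using hμ
    exact h.symm.trans h2
  · have h := (ContinuousLinearMap.snd ℝ E E).integral_comp_comm hi
    have h2 : ∫ z : E × E, z.2 ∂μ.prod μ = 0 := by
      rw [integral_fun_snd (fun x : E => x)]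
      simpa using hμ
    exact h.symm.trans h2

/-- The cross term vanishes because the two coordinates are independent and centred. -/
theorem uncenteredCovarianceBilinDual_prod_self (hμ : μ[id] = 0) (L : StrongDual ℝ (E × E)) :
    uncenteredCovarianceBilinDual (μ.prod μ) L L =
      uncenteredCovarianceBilinDual μ (L.comp (.inl ℝ E E)) (L.comp (.inl ℝ E E)) +
      uncenteredCovarianceBilinDual μ (L.comp (.inr ℝ E E)) (L.comp (.inr ℝ E E)) := by
  set L₁ := L.comp (.inl ℝ E E)
  set L₂ := L.comp (.inr ℝ E E)
  have hL : ∀ z : E × E, L z * L z = L₁ z.1 * L₁ z.1 + 2 * (L₁ z.1 * L₂ z.2) + L₂ z.2 * L₂ z.2 := by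
    intro z
    have : L z = L₁ z.1 + L₂ z.2 := by
      simp [L₁, L₂, ← map_add]
    rw [this]; ring
  have hL1 : PolyBound (id : E × E → E × E) fun z => L₁ z.1 :=
    (PolyBound.const L₁).clm_apply (polyBound_fst id)
  have hL2 : PolyBound (id : E × E → E × E) fun z => L₂ z.2 :=
    (PolyBound.const L₂).clm_apply (polyBound_snd id)
  have i1 : Integrable (fun z : E × E => L₁ z.1 * L₁ z.1) (μ.prod μ) :=
    (hL1.mul hL1).integrable _ (by fun_prop)
  have i2 : Integrable (fun z : E × E => L₁ z.1 * L₂ z.2) (μ.prod μ) :=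
    (hL1.mul hL2).integrable _ (by fun_prop)
  have i3 : Integrable (fun z : E × E => L₂ z.2 * L₂ z.2) (μ.prod μ) :=
    (hL2.mul hL2).integrable _ (by fun_prop)
  have h0 : ∫ x, L₁ x ∂μ = 0 := by
    rw [IsGaussian.integral_dual, show ∫ x, x ∂μ = 0 from hμ, map_zero]
  simp only [uncenteredCovarianceBilinDual_eq, hL]
  have i4 : Integrable (fun z : E × E => L₁ z.1 * L₁ z.1 + 2 * (L₁ z.1 * L₂ z.2)) (μ.prod μ) :=
    i1.add (i2.const_mul 2)
  rw [integral_add i4 i3, integral_add i1 (i2.const_mul 2), integral_const_mul, integral_prod_mul, h0,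
    integral_fun_fst (fun x => L₁ x * L₁ x), integral_fun_snd (fun x => L₂ x * L₂ x)]
  simp

/-- The derivative of `z ↦ ⟨G z.1, G (rotPoint t z)⟩` for the covariance inner product. -/
noncomputable def rotCorrDeriv (μ : Measure E) (G : E → StrongDual ℝ E)
    (H : E → E →L[ℝ] StrongDual ℝ E) (t : ℝ) (z : E × E) : StrongDual ℝ (E × E) :=
  (uncenteredCovarianceBilinDual μ (G z.1)).comp ((H (rotPoint t z)).comp
    (Real.cos t • .fst ℝ E E + Real.sin t • .snd ℝ E E)) +
  ((uncenteredCovarianceBilinDual μ).flip (G (rotPoint t z))).comp ((H z.1).comp (.fst ℝ E E))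

omit [CompleteSpace E] [SecondCountableTopology E] [IsGaussian μ] in
theorem rotCorrDeriv_apply (G : E → StrongDual ℝ E) (H : E → E →L[ℝ] StrongDual ℝ E) (t : ℝ)
    (z v : E × E) :
    rotCorrDeriv μ G H t z v =
      uncenteredCovarianceBilinDual μ (G z.1) (H (rotPoint t z) (rotPoint t v)) +
      uncenteredCovarianceBilinDual μ (H z.1 v.1) (G (rotPoint t z)) := by
  simp [rotCorrDeriv, rotPoint]

theorem abs_rotCorrDeriv_apply_le {G : E → StrongDual ℝ E} {H : E → E →L[ℝ] StrongDual ℝ E}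
    {s : ℝ} (hs0 : 0 ≤ s)
    (hs : ∀ l : StrongDual ℝ E, uncenteredCovarianceBilinDual μ l l ≤ s * ‖l‖ ^ 2) (t : ℝ)
    (z v : E × E) :
    |rotCorrDeriv μ G H t z v| ≤ s * (‖G z.1‖ * ‖H (rotPoint t z)‖ * ‖rotPoint t v‖ +
      ‖H z.1‖ * ‖G (rotPoint t z)‖ * ‖v.1‖) := by
  rw [rotCorrDeriv_apply]
  refine (abs_add_le _ _).trans ?_
  rw [mul_add]
  refine add_le_add ((abs_uncenteredCovarianceBilinDual_le hs _ _).trans ?_)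
    ((abs_uncenteredCovarianceBilinDual_le hs _ _).trans ?_)
  · rw [mul_assoc]
    gcongr
    exact (H _).le_opNorm _
  · rw [mul_right_comm]
    gcongr
    exact (H _).le_opNorm _

set_option maxSynthPendingDepth 3 in
-- This makes the gradient correlation `U_t` admissible for the Poincaré inequality on the product
-- space.
theorem hasTameFDeriv_rotCorr {G : E → StrongDual ℝ E} {H : E → E →L[ℝ] StrongDual ℝ E}
    (hG : HasTameFDeriv G H) {s : ℝ} (hs0 : 0 ≤ s)
    (hs : ∀ l : StrongDual ℝ E, uncenteredCovarianceBilinDual μ l l ≤ s * ‖l‖ ^ 2) (t : ℝ) :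
    HasTameFDeriv (fun z : E × E => uncenteredCovarianceBilinDual μ (G z.1) (G (rotPoint t z)))
      (rotCorrDeriv μ G H t) := by
  have hGc := hG.continuous
  have hHc := hG.continuous_fderiv
  have hP := continuous_rotPoint (E := E) t
  have bP : PolyBound (id : E × E → E × E) (rotPoint t) := polyBound_rotPoint (fun _ => t) id
  have bG1 : PolyBound (id : E × E → E × E) fun z => G z.1 :=
    (hG.polyBound.comp _).trans (polyBound_fst id)
  have bG2 : PolyBound (id : E × E → E × E) fun z => G (rotPoint t z) :=
    (hG.polyBound.comp _).trans bP
  have bH1 : PolyBound (id : E × E → E × E) fun z => H z.1 :=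
    (hG.polyBound_fderiv.comp _).trans (polyBound_fst id)
  have bH2 : PolyBound (id : E × E → E × E) fun z => H (rotPoint t z) :=
    (hG.polyBound_fderiv.comp _).trans bP
  refine ⟨fun z => ?_, ?_, polyBound_bilin bG1 bG2, ?_⟩
  · have h1 : HasFDerivAt (fun z : E × E => G z.1) ((H z.1).comp (.fst ℝ E E)) z :=
      (hG.hasFDerivAt z.1).comp z hasFDerivAt_fst
    have h2 : HasFDerivAt (rotPoint (E := E) t)
        (Real.cos t • .fst ℝ E E + Real.sin t • .snd ℝ E E) z :=
      (hasFDerivAt_fst.const_smul _).add (hasFDerivAt_snd.const_smul _)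
    have h3 : HasFDerivAt (fun z : E × E => G (rotPoint t z))
        ((H (rotPoint t z)).comp (Real.cos t • .fst ℝ E E + Real.sin t • .snd ℝ E E)) z :=
      (hG.hasFDerivAt _).comp z h2
    have h4 : HasFDerivAt (fun z : E × E => uncenteredCovarianceBilinDual μ (G z.1))
        ((uncenteredCovarianceBilinDual μ).comp ((H z.1).comp (.fst ℝ E E))) z :=
      (uncenteredCovarianceBilinDual μ).hasFDerivAt.comp z h1
    -- The product rule flips the composed map, while `rotCorrDeriv` flips the bilinear form first.
    have h5 : rotCorrDeriv μ G H t z =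
        (uncenteredCovarianceBilinDual μ (G z.1)).comp ((H (rotPoint t z)).comp
          (Real.cos t • .fst ℝ E E + Real.sin t • .snd ℝ E E)) +
        ((uncenteredCovarianceBilinDual μ).comp ((H z.1).comp (.fst ℝ E E))).flip
          (G (rotPoint t z)) := by
      ext v <;> simp [rotCorrDeriv]
    rw [h5]
    exact h4.clm_apply h3
  · unfold rotCorrDeriv
    fun_prop
  · refine ((PolyBound.const s).mul (((bG1.norm.mul bH2.norm).mul (PolyBound.const 2)).add
      (bH1.norm.mul bG2.norm))).of_le fun z => ?_
    refine (ContinuousLinearMap.opNorm_le_bound _ (by positivity) fun v => ?_).trans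
      (le_abs_self _)
    refine (abs_rotCorrDeriv_apply_le hs0 hs t z v).trans ?_
    rw [mul_assoc s, add_mul, mul_assoc _ (2 : ℝ)]
    have h1 := norm_rotPoint_le t v
    have h2 := norm_fst_le v
    have h3 := norm_snd_le v
    gcongr
    linarith

/-- The partial derivatives in the two independent coordinates have norms at most `s (p |cos t| +
q)` and `s p |sin t|`. Since `cos² + sin² = 1`, their squares sum to at most `2 s² (p² + q²)`; the
third factor `s` comes from the covariance form itself. -/
theorem uncenteredCovarianceBilinDual_rotCorrDeriv_le {G : E → StrongDual ℝ E}
    {H : E → E →L[ℝ] StrongDual ℝ E} (hμ : μ[id] = 0) {s : ℝ} (hs0 : 0 ≤ s)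
    (hs : ∀ l : StrongDual ℝ E, uncenteredCovarianceBilinDual μ l l ≤ s * ‖l‖ ^ 2) (t : ℝ)
    (z : E × E) :
    uncenteredCovarianceBilinDual (μ.prod μ) (rotCorrDeriv μ G H t z) (rotCorrDeriv μ G H t z) ≤
      2 * s ^ 3 *
        (‖G z.1‖ ^ 2 * ‖H (rotPoint t z)‖ ^ 2 + ‖G (rotPoint t z)‖ ^ 2 * ‖H z.1‖ ^ 2) := by
  rw [uncenteredCovarianceBilinDual_prod_self hμ]
  set p := ‖G z.1‖ * ‖H (rotPoint t z)‖ with hp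
  set q := ‖H z.1‖ * ‖G (rotPoint t z)‖ with hq
  have hp0 : 0 ≤ p := by positivity
  have hq0 : 0 ≤ q := by positivity
  have n1 : ‖(rotCorrDeriv μ G H t z).comp (.inl ℝ E E)‖ ≤ s * (p * |Real.cos t| + q) := by
    refine ContinuousLinearMap.opNorm_le_bound _ (by positivity) fun v => ?_
    refine (abs_rotCorrDeriv_apply_le hs0 hs t z (v, 0)).trans (le_of_eq ?_)
    simp [rotPoint, norm_smul, hp, hq]
    ring
  have n2 : ‖(rotCorrDeriv μ G H t z).comp (.inr ℝ E E)‖ ≤ s * (p * |Real.sin t|) := by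
    refine ContinuousLinearMap.opNorm_le_bound _ (by positivity) fun v => ?_
    refine (abs_rotCorrDeriv_apply_le hs0 hs t z (0, v)).trans (le_of_eq ?_)
    simp [rotPoint, norm_smul, hp]
    ring
  have b1 := (hs ((rotCorrDeriv μ G H t z).comp (.inl ℝ E E))).trans
    (mul_le_mul_of_nonneg_left (pow_le_pow_left₀ (norm_nonneg _) n1 2) hs0)
  have b2 := (hs ((rotCorrDeriv μ G H t z).comp (.inr ℝ E E))).trans
    (mul_le_mul_of_nonneg_left (pow_le_pow_left₀ (norm_nonneg _) n2 2) hs0)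
  have key : (p * |Real.cos t| + q) ^ 2 + (p * |Real.sin t|) ^ 2 ≤ 2 * (p ^ 2 + q ^ 2) := by
    have h1 : |Real.cos t| ^ 2 + |Real.sin t| ^ 2 = 1 := by
      simp only [sq_abs, Real.cos_sq_add_sin_sq]
    have h2 : 2 * (p * q) * |Real.cos t| ≤ 2 * (p * q) :=
      mul_le_of_le_one_right (by positivity) (Real.abs_cos_le_one t)
    have h3 : (p * |Real.cos t| + q) ^ 2 + (p * |Real.sin t|) ^ 2
        = p ^ 2 * (|Real.cos t| ^ 2 + |Real.sin t| ^ 2) + q ^ 2 + 2 * (p * q) * |Real.cos t| := by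
      ring
    rw [h3, h1]
    nlinarith [sq_nonneg (p - q)]
  calc _ ≤ s ^ 3 * ((p * |Real.cos t| + q) ^ 2 + (p * |Real.sin t|) ^ 2) := by
        refine (add_le_add b1 b2).trans (le_of_eq ?_)
        ring
    _ ≤ s ^ 3 * (2 * (p ^ 2 + q ^ 2)) := by gcongr
    _ = _ := by rw [hp, hq]; ring

/-- Cauchy–Schwarz through a weighted arithmetic-geometric mean, with weights chosen so that each
half contributes `k₁² k₂² / 2`; the weights need `k₁` and `k₂` nonzero. -/
theorem integral_sq_mul_sq_le {α : Type*} [MeasurableSpace α] {ν : Measure α} {u v : α → ℝ}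
    (hu : Integrable (fun x => u x ^ 4) ν) (hv : Integrable (fun x => v x ^ 4) ν)
    (huv : Integrable (fun x => u x ^ 2 * v x ^ 2) ν) {k₁ k₂ : ℝ} (h₁ : 0 < k₁) (h₂ : 0 < k₂)
    (hk₁ : ∫ x, u x ^ 4 ∂ν ≤ k₁ ^ 4) (hk₂ : ∫ x, v x ^ 4 ∂ν ≤ k₂ ^ 4) :
    ∫ x, u x ^ 2 * v x ^ 2 ∂ν ≤ k₁ ^ 2 * k₂ ^ 2 := by
  calc ∫ x, u x ^ 2 * v x ^ 2 ∂ν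
      ≤ ∫ x, ((k₂ ^ 2 / (2 * k₁ ^ 2)) * u x ^ 4 + (k₁ ^ 2 / (2 * k₂ ^ 2)) * v x ^ 4) ∂ν := by
        refine integral_mono huv ((hu.const_mul _).add (hv.const_mul _)) fun x => ?_
        have h : (k₂ ^ 2 / (2 * k₁ ^ 2)) * u x ^ 4 + (k₁ ^ 2 / (2 * k₂ ^ 2)) * v x ^ 4
            - u x ^ 2 * v x ^ 2 = (k₂ ^ 2 * u x ^ 2 - k₁ ^ 2 * v x ^ 2) ^ 2
              / (2 * k₁ ^ 2 * k₂ ^ 2) := by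
          field_simp
          ring
        have : 0 ≤ (k₂ ^ 2 * u x ^ 2 - k₁ ^ 2 * v x ^ 2) ^ 2 / (2 * k₁ ^ 2 * k₂ ^ 2) := by
          positivity
        simp only
        linarith
    _ = (k₂ ^ 2 / (2 * k₁ ^ 2)) * ∫ x, u x ^ 4 ∂ν + (k₁ ^ 2 / (2 * k₂ ^ 2)) * ∫ x, v x ^ 4 ∂ν := by
        rw [integral_add (hu.const_mul _) (hv.const_mul _), integral_const_mul, integral_const_mul]
    _ ≤ (k₂ ^ 2 / (2 * k₁ ^ 2)) * k₁ ^ 4 + (k₁ ^ 2 / (2 * k₂ ^ 2)) * k₂ ^ 4 := by gcongr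
    _ = _ := by field_simp; ring

/-- Poincaré on the product space, then Cauchy–Schwarz. The start and the rotated point both have
law `μ`, so both mixed moments obey the same bound. -/
theorem variance_rotCorr_le {G : E → StrongDual ℝ E}
    {H : E → E →L[ℝ] StrongDual ℝ E} (hG : HasTameFDeriv G H) (hμ : μ[id] = 0) {s : ℝ}
    (hs0 : 0 ≤ s) (hs : ∀ l : StrongDual ℝ E, uncenteredCovarianceBilinDual μ l l ≤ s * ‖l‖ ^ 2)
    {k₁ k₂ : ℝ} (h₁ : 0 < k₁) (h₂ : 0 < k₂) (hk₁ : ∫ x, ‖G x‖ ^ 4 ∂μ ≤ k₁ ^ 4)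
    (hk₂ : ∫ x, ‖H x‖ ^ 4 ∂μ ≤ k₂ ^ 4) (t : ℝ) {U : E × E → ℝ}
    (hU : U = fun z => uncenteredCovarianceBilinDual μ (G z.1) (G (rotPoint t z))) :
    ∫ z, U z * U z ∂μ.prod μ - (∫ z, U z ∂μ.prod μ) * ∫ z, U z ∂μ.prod μ
      ≤ 4 * s ^ 3 * (k₁ ^ 2 * k₂ ^ 2) := by
  have hGc := hG.continuous
  have hHc := hG.continuous_fderiv
  have hP := continuous_rotPoint (E := E) t
  have hHn : Continuous fun x => ‖H x‖ := hHc.norm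
  have cH2 : Continuous fun z : E × E => ‖H (rotPoint t z)‖ := hHn.comp hP
  have cH1 : Continuous fun z : E × E => ‖H z.1‖ := hHn.comp continuous_fst
  have cG2 : Continuous fun z : E × E => ‖G (rotPoint t z)‖ := (hGc.comp hP).norm
  have cG1 : Continuous fun z : E × E => ‖G z.1‖ := (hGc.comp continuous_fst).norm
  have bP : PolyBound (id : E × E → E × E) (rotPoint t) := polyBound_rotPoint (fun _ => t) id
  have bG1 : PolyBound (id : E × E → E × E) fun z => ‖G z.1‖ :=
    ((hG.polyBound.comp _).trans (polyBound_fst id)).norm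
  have bG2 : PolyBound (id : E × E → E × E) fun z => ‖G (rotPoint t z)‖ :=
    ((hG.polyBound.comp _).trans bP).norm
  have bH1 : PolyBound (id : E × E → E × E) fun z => ‖H z.1‖ :=
    ((hG.polyBound_fderiv.comp _).trans (polyBound_fst id)).norm
  have bH2 : PolyBound (id : E × E → E × E) fun z => ‖H (rotPoint t z)‖ :=
    ((hG.polyBound_fderiv.comp _).trans bP).norm
  have htame := hasTameFDeriv_rotCorr hG hs0 hs t
  rw [← hU] at htame
  refine (gaussian_poincare (integral_id_prod_self hμ) htame).trans ?_
  have eG1 : ∫ z : E × E, ‖G z.1‖ ^ 4 ∂μ.prod μ ≤ k₁ ^ 4 := by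
    rw [integral_fun_fst (fun x => ‖G x‖ ^ 4)]; simpa using hk₁
  have eH1 : ∫ z : E × E, ‖H z.1‖ ^ 4 ∂μ.prod μ ≤ k₂ ^ 4 := by
    rw [integral_fun_fst (fun x => ‖H x‖ ^ 4)]; simpa using hk₂
  have eG2 : ∫ z : E × E, ‖G (rotPoint t z)‖ ^ 4 ∂μ.prod μ ≤ k₁ ^ 4 := by
    rwa [integral_rotPoint hμ t (F := fun x => ‖G x‖ ^ 4) (by fun_prop)]
  have eH2 : ∫ z : E × E, ‖H (rotPoint t z)‖ ^ 4 ∂μ.prod μ ≤ k₂ ^ 4 := by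
    rwa [integral_rotPoint hμ t (F := fun x => ‖H x‖ ^ 4) (hHn.pow 4)]
  have i1 : Integrable (fun z : E × E => ‖G z.1‖ ^ 2 * ‖H (rotPoint t z)‖ ^ 2) (μ.prod μ) :=
    ((bG1.pow 2).mul (bH2.pow 2)).integrable _ ((cG1.pow 2).mul (cH2.pow 2)).aestronglyMeasurable
  have i2 : Integrable (fun z : E × E => ‖G (rotPoint t z)‖ ^ 2 * ‖H z.1‖ ^ 2) (μ.prod μ) :=
    ((bG2.pow 2).mul (bH1.pow 2)).integrable _ ((cG2.pow 2).mul (cH1.pow 2)).aestronglyMeasurable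
  have c1 := integral_sq_mul_sq_le ((bG1.pow 4).integrable _ (cG1.pow 4).aestronglyMeasurable)
    ((bH2.pow 4).integrable _ (cH2.pow 4).aestronglyMeasurable) i1 h₁ h₂ eG1 eH2
  have c2 := integral_sq_mul_sq_le ((bG2.pow 4).integrable _ (cG2.pow 4).aestronglyMeasurable)
    ((bH1.pow 4).integrable _ (cH1.pow 4).aestronglyMeasurable) i2 h₁ h₂ eG2 eH1
  have hUc := htame.continuous_fderiv
  calc _ ≤ ∫ z : E × E, 2 * s ^ 3 * (‖G z.1‖ ^ 2 * ‖H (rotPoint t z)‖ ^ 2 +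
        ‖G (rotPoint t z)‖ ^ 2 * ‖H z.1‖ ^ 2) ∂μ.prod μ := by
        refine integral_mono ?_ ((i1.add i2).const_mul _) fun z =>
          uncenteredCovarianceBilinDual_rotCorrDeriv_le hμ hs0 hs t z
        exact (polyBound_bilin htame.polyBound_fderiv htame.polyBound_fderiv).integrable _
          (by fun_prop)
    _ = 2 * s ^ 3 * (∫ z : E × E, ‖G z.1‖ ^ 2 * ‖H (rotPoint t z)‖ ^ 2 ∂μ.prod μ +
        ∫ z : E × E, ‖G (rotPoint t z)‖ ^ 2 * ‖H z.1‖ ^ 2 ∂μ.prod μ) := by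
        rw [integral_const_mul, integral_add i1 i2]
    _ ≤ 2 * s ^ 3 * (k₁ ^ 2 * k₂ ^ 2 + k₁ ^ 2 * k₂ ^ 2) := by gcongr
    _ = _ := by ring

/-- Integrate `|y| ≤ y² / (2b) + b / 2` at the deviation from the mean. -/
theorem integral_abs_sub_integral_le {α : Type*} [MeasurableSpace α] {ν : Measure α}
    [IsProbabilityMeasure ν] {U : α → ℝ} (hU : Integrable U ν)
    (hU2 : Integrable (fun x => U x * U x) ν) {b : ℝ} (hb : 0 < b)
    (h : ∫ x, U x * U x ∂ν - (∫ x, U x ∂ν) * ∫ x, U x ∂ν ≤ b ^ 2) :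
    ∫ x, |U x - ∫ y, U y ∂ν| ∂ν ≤ b := by
  set m := ∫ y, U y ∂ν with hm
  have i1 : Integrable (fun x => U x * U x - 2 * m * U x) ν := hU2.sub (hU.const_mul (2 * m))
  have i3 : Integrable (fun x => U x * U x - 2 * m * U x + m * m) ν :=
    i1.add (integrable_const _)
  have i4 : Integrable (fun x => (U x * U x - 2 * m * U x + m * m) / (2 * b)) ν :=
    i3.div_const _
  have i2 : Integrable (fun x => (U x * U x - 2 * m * U x + m * m) / (2 * b) + b / 2) ν :=
    i4.add (integrable_const _)
  calc ∫ x, |U x - m| ∂ν ≤ ∫ x, ((U x * U x - 2 * m * U x + m * m) / (2 * b) + b / 2) ∂ν := by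
        refine integral_mono (hU.sub (integrable_const m)).abs i2 fun x => ?_
        have h1 : (U x * U x - 2 * m * U x + m * m) / (2 * b) + b / 2 - |U x - m|
            = (|U x - m| - b) ^ 2 / (2 * b) := by
          have : U x * U x - 2 * m * U x + m * m = |U x - m| ^ 2 := by rw [sq_abs]; ring
          rw [this]
          field_simp
          ring
        have : 0 ≤ (|U x - m| - b) ^ 2 / (2 * b) := by positivity
        simp only
        linarith
    _ = (∫ x, U x * U x ∂ν - m * m) / (2 * b) + b / 2 := by
        rw [integral_add i4 (integrable_const _),
          integral_div, integral_add i1 (integrable_const _),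
          integral_sub hU2 (hU.const_mul (2 * m)), integral_const_mul, ← hm]
        simp only [integral_const, probReal_univ, smul_eq_mul, one_mul]
        ring
    _ ≤ b ^ 2 / (2 * b) + b / 2 := by gcongr
    _ = b := by field_simp; ring

/-- The second order Poincaré inequality, in the form of an approximate Stein identity. -/
theorem gaussian_second_order_poincare (hμ : μ[id] = 0) {g : E → ℝ} {G : E → StrongDual ℝ E}
    {H : E → E →L[ℝ] StrongDual ℝ E} (hg : HasTameFDeriv g G) (hG : HasTameFDeriv G H) {s : ℝ}
    (hs0 : 0 < s) (hs : ∀ l : StrongDual ℝ E, uncenteredCovarianceBilinDual μ l l ≤ s * ‖l‖ ^ 2)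
    {k₁ k₂ : ℝ} (h₁ : 0 < k₁) (h₂ : 0 < k₂) (hk₁ : ∫ x, ‖G x‖ ^ 4 ∂μ ≤ k₁ ^ 4)
    (hk₂ : ∫ x, ‖H x‖ ^ 4 ∂μ ≤ k₂ ^ 4) {ψ ψ' : ℝ → ℝ} {M : ℝ}
    (hψ : ∀ x, HasDerivAt ψ (ψ' x) x) (hψ' : Continuous ψ') (hM : ∀ x, |ψ' x| ≤ M) :
    |(∫ x, g x * ψ (g x) ∂μ - (∫ x, g x ∂μ) * ∫ x, ψ (g x) ∂μ) -
      (∫ x, ψ' (g x) ∂μ) * (∫ x, g x * g x ∂μ - (∫ x, g x ∂μ) * ∫ x, g x ∂μ)|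
      ≤ M * (2 * √(s ^ 3) * (k₁ * k₂)) := by
  have hM0 : 0 ≤ M := (abs_nonneg _).trans (hM 0)
  have hgc := hg.continuous
  have hGc := hG.continuous
  have hF := hg.comp_of_deriv_bounded hψ hψ' hM
  set c := ∫ x, ψ' (g x) ∂μ with hc
  -- Subtracting `c` times the correlation of `g` with itself turns the derivative into `-sin t E
  -- ψ'(g) (U_t - E U_t)`, because `c` is the mean of `ψ'(g)`.
  have hder := fun t => (hasDerivAt_integral_rotPoint_mul hμ hg hF t).sub
    ((hasDerivAt_integral_rotPoint_mul hμ hg hg t).const_mul c)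
  have h := abs_sub_le_of_deriv_le_sin (M := M * (2 * √(s ^ 3) * (k₁ * k₂))) hder fun t ht => by
    set U : E × E → ℝ := fun z => uncenteredCovarianceBilinDual μ (G z.1) (G (rotPoint t z))
      with hU
    have htame := hasTameFDeriv_rotCorr hG hs0.le hs t
    rw [← hU] at htame
    have hUc := htame.continuous
    have iU : Integrable U (μ.prod μ) := htame.polyBound.integrable _ (by fun_prop)
    have hi := integral_abs_sub_integral_le iU
      ((htame.polyBound.mul htame.polyBound).integrable _ (by fun_prop))
      (b := 2 * √(s ^ 3) * (k₁ * k₂)) (by positivity)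
      ((variance_rotCorr_le hG hμ hs0.le hs h₁ h₂ hk₁ hk₂ t hU).trans (le_of_eq (by
        rw [mul_pow, mul_pow, Real.sq_sqrt (by positivity)]; ring)))
    have e1 : ∫ z : E × E, uncenteredCovarianceBilinDual μ (G (rotPoint t z))
        (ψ' (g z.1) • G z.1) ∂μ.prod μ = ∫ z, ψ' (g z.1) * U z ∂μ.prod μ := by
      refine integral_congr_ae (Filter.Eventually.of_forall fun z => ?_)
      simp only [map_smul, smul_eq_mul, hU]
      rw [uncenteredCovarianceBilinDual_comm]
    have e2 : ∫ z : E × E, uncenteredCovarianceBilinDual μ (G (rotPoint t z)) (G z.1) ∂μ.prod μ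
        = ∫ z, U z ∂μ.prod μ := by
      refine integral_congr_ae (Filter.Eventually.of_forall fun z => ?_)
      simp only [hU]
      rw [uncenteredCovarianceBilinDual_comm]
    have bψ : PolyBound (id : E × E → E × E) fun z => ψ' (g z.1) :=
      (PolyBound.const M).of_le fun z => (hM _).trans (le_abs_self M)
    have i1 : Integrable (fun z : E × E => ψ' (g z.1) * U z) (μ.prod μ) :=
      (bψ.mul htame.polyBound).integrable _ (by fun_prop)
    have i2 : Integrable (fun z : E × E => ψ' (g z.1) * ∫ y, U y ∂μ.prod μ) (μ.prod μ) :=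
      (bψ.mul (PolyBound.const _)).integrable _ (by fun_prop)
    have e3 : ∫ z, ψ' (g z.1) * U z ∂μ.prod μ - c * ∫ z, U z ∂μ.prod μ
        = ∫ z, ψ' (g z.1) * (U z - ∫ y, U y ∂μ.prod μ) ∂μ.prod μ := by
      simp only [mul_sub]
      rw [integral_sub i1 i2, integral_mul_const, integral_fun_fst (fun x => ψ' (g x))]
      simp [hc]
    have e4 : |∫ z, ψ' (g z.1) * (U z - ∫ y, U y ∂μ.prod μ) ∂μ.prod μ|
        ≤ M * (2 * √(s ^ 3) * (k₁ * k₂)) := by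
      refine abs_integral_le_integral_abs.trans ?_
      refine le_trans ?_ (mul_le_mul_of_nonneg_left hi hM0)
      rw [← integral_const_mul]
      refine integral_mono_of_nonneg (Filter.Eventually.of_forall fun z => abs_nonneg _)
        ((iU.sub (integrable_const _)).abs.const_mul M) (Filter.Eventually.of_forall fun z => ?_)
      simp only [abs_mul]
      exact mul_le_mul_of_nonneg_right (hM _) (abs_nonneg _)
    rw [e1, e2]
    calc _ = |-Real.sin t * (∫ z, ψ' (g z.1) * U z ∂μ.prod μ - c * ∫ z, U z ∂μ.prod μ)| := by
          congr 1; ring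
      _ = |∫ z, ψ' (g z.1) * (U z - ∫ y, U y ∂μ.prod μ) ∂μ.prod μ| * Real.sin t := by
          rw [e3, abs_mul, abs_neg, abs_of_nonneg ht, mul_comm]
      _ ≤ _ := mul_le_mul_of_nonneg_right e4 ht
  simp only [integral_rotPoint_mul_zero (g := g) (F := fun x => ψ (g x)),
    integral_rotPoint_mul_zero (g := g) (F := g),
    integral_rotPoint_mul_pi_div_two (g := g) (F := fun x => ψ (g x)),
    integral_rotPoint_mul_pi_div_two (g := g) (F := g), Pi.sub_apply] at h
  refine le_trans (le_of_eq ?_) h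
  congr 1
  ring

end SecondOrder

/-! ### Total variation through continuous test functions -/

section TotalVariation

/-- Thickened indicators carry the bound to closed sets. For a general set, inner regularity by
closed sets is used for the measure giving the positive term, and monotonicity for the other. -/
theorem tvDist_le_of_continuous {E : Type*} [PseudoEMetricSpace E] [MeasurableSpace E]
    [BorelSpace E] {μ ν : Measure E} [IsProbabilityMeasure μ] [IsProbabilityMeasure ν] {K : ℝ}
    (h : ∀ u : E → ℝ, Continuous u → (∀ x, 0 ≤ u x) → (∀ x, u x ≤ 1) →
      |∫ x, u x ∂μ - ∫ x, u x ∂ν| ≤ K) :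
    tvDist μ ν ≤ ENNReal.ofReal K := by
  have hclosed : ∀ F : Set E, IsClosed F → |μ.real F - ν.real F| ≤ K := by
    intro F hF
    have hpos : ∀ k : ℕ, (0 : ℝ) < 1 / ((k : ℝ) + 1) := fun k => by positivity
    have t1 := tendsto_integral_thickenedIndicator_of_isClosed μ hF hpos
      tendsto_one_div_add_atTop_nhds_zero_nat
    have t2 := tendsto_integral_thickenedIndicator_of_isClosed ν hF hpos
      tendsto_one_div_add_atTop_nhds_zero_nat
    refine le_of_tendsto (t1.sub t2).abs (Filter.Eventually.of_forall fun k => ?_)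
    refine h (fun x => (thickenedIndicator (hpos k) F x : ℝ)) (by fun_prop)
      (fun x => NNReal.coe_nonneg _) fun x => ?_
    exact_mod_cast thickenedIndicator_le_one (hpos k) F x
  have approx : ∀ (ρ : Measure E) [IsProbabilityMeasure ρ] (B : Set E), MeasurableSet B →
      ∀ ε : ℝ, 0 < ε → ∃ F ⊆ B, IsClosed F ∧ ρ.real B ≤ ρ.real F + ε := by
    intro ρ _ B hB ε hε
    obtain ⟨F, hFB, hF, hlt⟩ := hB.exists_isClosed_lt_add (measure_ne_top ρ B)
      (ENNReal.ofReal_pos.2 hε).ne'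
    refine ⟨F, hFB, hF, ?_⟩
    have := ENNReal.toReal_mono (by finiteness) hlt.le
    rwa [ENNReal.toReal_add (measure_ne_top _ _) ENNReal.ofReal_ne_top,
      ENNReal.toReal_ofReal hε.le] at this
  refine iSup₂_le fun B hB => ENNReal.ofReal_le_ofReal ?_
  refine abs_sub_le_iff.2 ⟨le_of_forall_pos_le_add fun ε hε => ?_,
    le_of_forall_pos_le_add fun ε hε => ?_⟩
  · obtain ⟨F, hFB, hF, hle⟩ := approx μ B hB ε hε
    have h1 := (abs_le.1 (hclosed F hF)).2
    have h2 : ν.real F ≤ ν.real B := measureReal_mono hFB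
    linarith
  · obtain ⟨F, hFB, hF, hle⟩ := approx ν B hB ε hε
    have h1 := (abs_le.1 (hclosed F hF)).1
    have h2 : μ.real F ≤ μ.real B := measureReal_mono hFB
    linarith

end TotalVariation

/-! ### Stein's method for the normal law -/

section Stein

open scoped NNReal

variable {m : ℝ} {v : ℝ≥0}

theorem hasDerivAt_gaussianPDFReal (m : ℝ) (v : ℝ≥0) (x : ℝ) :
    HasDerivAt (gaussianPDFReal m v) (-((x - m) / v) * gaussianPDFReal m v x) x := by
  have h : HasDerivAt (fun x => -(x - m) ^ 2 / (2 * (v : ℝ))) (-((x - m) / v)) x := by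
    refine ((((hasDerivAt_id x).sub_const m).pow 2).neg.div_const (2 * (v : ℝ))).congr_deriv ?_
    simp only [id]
    push_cast
    ring
  refine (h.exp.const_mul (√(2 * Real.pi * v))⁻¹).congr_deriv ?_
  simp only [gaussianPDFReal]
  ring

theorem continuous_gaussianPDFReal (m : ℝ) (v : ℝ≥0) : Continuous (gaussianPDFReal m v) :=
  continuous_iff_continuousAt.2 fun x => (hasDerivAt_gaussianPDFReal m v x).continuousAt

theorem integrable_sub_mul_gaussianPDFReal (m : ℝ) (hv : v ≠ 0) :
    Integrable fun x => (x - m) * gaussianPDFReal m v x := by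
  have hv' : (0 : ℝ) < v := by positivity
  have h := ((integrable_mul_exp_neg_mul_sq (b := (2 * (v : ℝ))⁻¹)
    (by positivity)).comp_sub_right m).const_mul (√(2 * Real.pi * v))⁻¹
  refine h.congr (Filter.Eventually.of_forall fun x => ?_)
  simp only [gaussianPDFReal]
  rw [show -(x - m) ^ 2 / (2 * (v : ℝ)) = -(2 * (v : ℝ))⁻¹ * (x - m) ^ 2 by ring]
  ring

theorem hasDerivAt_mul_gaussianPDFReal (m : ℝ) (hv : v ≠ 0) (x : ℝ) :
    HasDerivAt (fun x => v * gaussianPDFReal m v x) (-((x - m) * gaussianPDFReal m v x)) x := by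
  refine ((hasDerivAt_gaussianPDFReal m v x).const_mul (v : ℝ)).congr_deriv ?_
  have hv' : (v : ℝ) ≠ 0 := by exact_mod_cast hv
  field_simp

theorem setIntegral_Ioi_sub_mul_gaussianPDFReal (m : ℝ) (hv : v ≠ 0) (x : ℝ) :
    ∫ y in Set.Ioi x, (y - m) * gaussianPDFReal m v y = v * gaussianPDFReal m v x := by
  have hi := (integrable_sub_mul_gaussianPDFReal m hv).neg
  have ht := tendsto_zero_of_hasDerivAt_of_integrableOn_Ioi (a := x)
    (fun y _ => hasDerivAt_mul_gaussianPDFReal m hv y) hi.integrableOn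
    ((integrable_gaussianPDFReal m v).const_mul (v : ℝ)).integrableOn
  have h := integral_Ioi_of_hasDerivAt_of_tendsto' (a := x)
    (fun y _ => hasDerivAt_mul_gaussianPDFReal m hv y) hi.integrableOn ht
  rw [integral_neg] at h
  linarith

theorem setIntegral_Iic_sub_mul_gaussianPDFReal (m : ℝ) (hv : v ≠ 0) (x : ℝ) :
    ∫ y in Set.Iic x, (m - y) * gaussianPDFReal m v y = v * gaussianPDFReal m v x := by
  have hi := (integrable_sub_mul_gaussianPDFReal m hv).neg
  have ht := tendsto_zero_of_hasDerivAt_of_integrableOn_Iic (a := x)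
    (fun y _ => hasDerivAt_mul_gaussianPDFReal m hv y) hi.integrableOn
    ((integrable_gaussianPDFReal m v).const_mul (v : ℝ)).integrableOn
  have h := integral_Iic_of_hasDerivAt_of_tendsto' (a := x)
    (fun y _ => hasDerivAt_mul_gaussianPDFReal m hv y) hi.integrableOn ht
  rw [sub_zero] at h
  rw [← h]
  congr 1
  funext y
  ring

/-- Left of the mean, `m - x ≤ m - y` throughout the tail, so the prefactor moves inside and the
tail integral is explicit. Right of the mean, the vanishing total integral replaces the left tail by
the right one. -/
theorem abs_sub_mul_setIntegral_Iic_le (hv : v ≠ 0) {k : ℝ → ℝ} (hk : ∀ y, |k y| ≤ 1)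
    (hi : Integrable fun y => k y * gaussianPDFReal m v y)
    (h0 : ∫ y, k y * gaussianPDFReal m v y = 0) (x : ℝ) :
    |(x - m) * ∫ y in Set.Iic x, k y * gaussianPDFReal m v y| ≤ v * gaussianPDFReal m v x := by
  have hi1 := integrable_sub_mul_gaussianPDFReal m hv
  have hi2 : Integrable fun y => (m - y) * gaussianPDFReal m v y :=
    hi1.neg.congr (Filter.Eventually.of_forall fun y => by simp only [Pi.neg_apply]; ring)
  have hp := integrable_gaussianPDFReal m v
  have hp0 := gaussianPDFReal_nonneg m v
  have hb : ∀ y, |k y * gaussianPDFReal m v y| ≤ gaussianPDFReal m v y := fun y => by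
    rw [abs_mul, abs_of_nonneg (hp0 y)]
    exact mul_le_of_le_one_left (hp0 y) (hk y)
  rw [abs_mul]
  rcases le_total x m with hx | hx
  · rw [abs_of_nonpos (sub_nonpos.2 hx), neg_sub, ← setIntegral_Iic_sub_mul_gaussianPDFReal m hv x]
    calc (m - x) * |∫ y in Set.Iic x, k y * gaussianPDFReal m v y|
        ≤ (m - x) * ∫ y in Set.Iic x, gaussianPDFReal m v y := by
          refine mul_le_mul_of_nonneg_left ?_ (sub_nonneg.2 hx)
          exact abs_integral_le_integral_abs.trans
            (integral_mono hi.abs.integrableOn hp.integrableOn hb)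
      _ = ∫ y in Set.Iic x, (m - x) * gaussianPDFReal m v y := (integral_const_mul _ _).symm
      _ ≤ _ := by
          refine setIntegral_mono_on (hp.const_mul _).integrableOn hi2.integrableOn
            measurableSet_Iic fun y hy => mul_le_mul_of_nonneg_right ?_ (hp0 y)
          exact sub_le_sub_left hy m
  · have hsplit : ∫ y in Set.Iic x, k y * gaussianPDFReal m v y
        = -∫ y in Set.Ioi x, k y * gaussianPDFReal m v y := by
      have := integral_add_compl (measurableSet_Iic (a := x)) hi
      rw [Set.compl_Iic, h0] at this
      linarith
    rw [hsplit, abs_neg, abs_of_nonneg (sub_nonneg.2 hx),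
      ← setIntegral_Ioi_sub_mul_gaussianPDFReal m hv x]
    calc (x - m) * |∫ y in Set.Ioi x, k y * gaussianPDFReal m v y|
        ≤ (x - m) * ∫ y in Set.Ioi x, gaussianPDFReal m v y := by
          refine mul_le_mul_of_nonneg_left ?_ (sub_nonneg.2 hx)
          exact abs_integral_le_integral_abs.trans
            (integral_mono hi.abs.integrableOn hp.integrableOn hb)
      _ = ∫ y in Set.Ioi x, (x - m) * gaussianPDFReal m v y := (integral_const_mul _ _).symm
      _ ≤ _ := by
          refine setIntegral_mono_on (hp.const_mul _).integrableOn hi1.integrableOn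
            measurableSet_Ioi fun y hy => mul_le_mul_of_nonneg_right ?_ (hp0 y)
          exact sub_le_sub_right (le_of_lt hy) m

/-- A solution of the Stein equation of `gaussianReal m v` with bounded continuous derivative. -/
theorem exists_stein_solution (m : ℝ) (hv : v ≠ 0) {u : ℝ → ℝ} (hu : Continuous u)
    (hu0 : ∀ x, 0 ≤ u x) (hu1 : ∀ x, u x ≤ 1) :
    ∃ ψ ψ' : ℝ → ℝ, (∀ x, HasDerivAt ψ (ψ' x) x) ∧ Continuous ψ' ∧ (∀ x, |ψ' x| ≤ 2 / v) ∧
      ∀ x, v * ψ' x - (x - m) * ψ x = u x - ∫ y, u y ∂gaussianReal m v := by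
  set η := ∫ y, u y ∂gaussianReal m v with hη
  set p := gaussianPDFReal m v with hp
  have hv' : (0 : ℝ) < v := by positivity
  have hp0 : ∀ x, 0 < p x := fun x => gaussianPDFReal_pos m v x hv
  have hpc : Continuous p := continuous_gaussianPDFReal m v
  have hpi : Integrable p := integrable_gaussianPDFReal m v
  have hui : Integrable u (gaussianReal m v) :=
    Integrable.of_bound hu.aestronglyMeasurable 1 (Filter.Eventually.of_forall fun x => by
      rw [Real.norm_eq_abs, abs_of_nonneg (hu0 x)]; exact hu1 x)
  have hη0 : 0 ≤ η := integral_nonneg hu0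
  have hη1 : η ≤ 1 := by
    have := integral_mono hui (integrable_const 1) hu1
    simpa using this
  set k : ℝ → ℝ := fun y => u y - η with hk
  have hk1 : ∀ y, |k y| ≤ 1 := fun y =>
    abs_sub_le_iff.2 ⟨by linarith [hu1 y], by linarith [hu0 y]⟩
  have hkc : Continuous k := by fun_prop
  have hqi : Integrable fun y => k y * p y := by
    refine hpi.mono (by fun_prop) (Filter.Eventually.of_forall fun y => ?_)
    rw [norm_mul]
    exact mul_le_of_le_one_left (norm_nonneg _) (hk1 y)
  have hq0 : ∫ y, k y * p y = 0 := by
    have h1 : ∫ y, k y ∂gaussianReal m v = 0 := by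
      rw [integral_sub hui (integrable_const η)]; simp [hη]
    rw [integral_gaussianReal_eq_integral_smul hv] at h1
    simpa [mul_comm, hp] using h1
  set I : ℝ → ℝ := fun x => ∫ y in Set.Iic x, k y * p y with hI
  have hId : ∀ x, HasDerivAt I (k x * p x) x := by
    intro x
    have h1 : I = fun x => I 0 + ∫ y in (0 : ℝ)..x, k y * p y := by
      funext x
      rw [← intervalIntegral.integral_Iic_sub_Iic hqi.integrableOn hqi.integrableOn]
      simp [hI]
    rw [h1]
    exact ((hkc.mul hpc).integral_hasStrictDerivAt 0 x).hasDerivAt.const_add _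
  have hpd : ∀ x, HasDerivAt (fun x => v * p x) (-((x - m) * p x)) x :=
    hasDerivAt_mul_gaussianPDFReal m hv
  -- With the density as integrating factor, the Stein equation reads `(v p ψ)' = k p`.
  set ψ : ℝ → ℝ := fun x => I x / (v * p x) with hψ
  have hψc : Continuous ψ := by
    have hIc : Continuous I := continuous_iff_continuousAt.2 fun x => (hId x).continuousAt
    exact hIc.div (by fun_prop) fun x => (mul_pos hv' (hp0 x)).ne'
  refine ⟨ψ, fun x => (k x + (x - m) * ψ x) / v, fun x => ?_, by fun_prop, fun x => ?_,
    fun x => ?_⟩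
  · refine ((hId x).div (hpd x) (mul_pos hv' (hp0 x)).ne').congr_deriv ?_
    have := (hp0 x).ne'
    simp only [hψ]
    field_simp
    ring
  · rw [abs_div, abs_of_pos hv']
    gcongr
    refine (abs_add_le _ _).trans ?_
    -- The constant `2` is one for `|k|` and one for `|(x - m) ψ x|`.
    have h1 := abs_sub_mul_setIntegral_Iic_le hv hk1 hqi hq0 x
    have h2 : |(x - m) * ψ x| ≤ 1 := by
      simp only [hψ, mul_div_assoc', abs_div]
      rw [abs_of_pos (mul_pos hv' (hp0 x))]
      exact (div_le_one (mul_pos hv' (hp0 x))).2 h1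
    linarith [hk1 x]
  · field_simp
    ring

/-- Stein's method: an approximate Stein identity bounds the total variation distance. -/
theorem tvDist_gaussianReal_le {ν : Measure ℝ} [IsProbabilityMeasure ν] (m : ℝ) (hv : v ≠ 0) {K : ℝ}
    (h : ∀ (ψ ψ' : ℝ → ℝ) (M : ℝ), (∀ x, HasDerivAt ψ (ψ' x) x) → Continuous ψ' →
      (∀ x, |ψ' x| ≤ M) → Integrable (fun x => (x - m) * ψ x) ν ∧
        |∫ x, (x - m) * ψ x ∂ν - v * ∫ x, ψ' x ∂ν| ≤ M * K) :
    tvDist ν (gaussianReal m v) ≤ ENNReal.ofReal (2 / v * K) := by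
  refine tvDist_le_of_continuous fun u hu hu0 hu1 => ?_
  obtain ⟨ψ, ψ', hψ, hψ', hM, heq⟩ := exists_stein_solution m hv hu hu0 hu1
  obtain ⟨hi, hle⟩ := h ψ ψ' _ hψ hψ' hM
  have hi' : Integrable ψ' ν :=
    Integrable.of_bound hψ'.aestronglyMeasurable _ (Filter.Eventually.of_forall hM)
  have hui : Integrable u ν :=
    Integrable.of_bound hu.aestronglyMeasurable 1 (Filter.Eventually.of_forall fun x => by
      rw [Real.norm_eq_abs, abs_of_nonneg (hu0 x)]; exact hu1 x)
  have h1 : ∫ x, u x ∂ν - ∫ y, u y ∂gaussianReal m v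
      = v * ∫ x, ψ' x ∂ν - ∫ x, (x - m) * ψ x ∂ν := by
    have h2 : ∫ x, (u x - ∫ y, u y ∂gaussianReal m v) ∂ν
        = ∫ x, (v * ψ' x - (x - m) * ψ x) ∂ν := by simp only [heq]
    rw [integral_sub hui (integrable_const _), integral_sub (hi'.const_mul _) hi,
      integral_const_mul] at h2
    simpa using h2
  rw [h1, abs_sub_comm]
  exact hle

end Stein

/-! ### Frobenius and operator norms -/

section Frobenius

open scoped Matrix.Norms.L2Operator Matrix

variable {n : ℕ}

/-- The Frobenius norm of a complex matrix. -/
noncomputable def frob (M : Matrix (Fin n) (Fin n) ℂ) : ℝ :=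
  ‖(WithLp.toLp 2 (fun p : Fin n × Fin n => M p.1 p.2) : EuclideanSpace ℂ (Fin n × Fin n))‖

theorem frob_nonneg (M : Matrix (Fin n) (Fin n) ℂ) : 0 ≤ frob M := norm_nonneg _

theorem frob_sq (M : Matrix (Fin n) (Fin n) ℂ) : frob M ^ 2 = ∑ j, ∑ i, ‖M i j‖ ^ 2 := by
  rw [frob, EuclideanSpace.norm_sq_eq, Fintype.sum_prod_type, Finset.sum_comm]

theorem frob_add_le (M N : Matrix (Fin n) (Fin n) ℂ) : frob (M + N) ≤ frob M + frob N :=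
  norm_add_le (WithLp.toLp 2 (fun p : Fin n × Fin n => M p.1 p.2) :
    EuclideanSpace ℂ (Fin n × Fin n)) (WithLp.toLp 2 (fun p : Fin n × Fin n => N p.1 p.2))

theorem frob_zero : frob (0 : Matrix (Fin n) (Fin n) ℂ) = 0 :=
  norm_zero (E := EuclideanSpace ℂ (Fin n × Fin n))

theorem frob_sum_le {ι : Type*} (s : Finset ι) (M : ι → Matrix (Fin n) (Fin n) ℂ) :
    frob (∑ i ∈ s, M i) ≤ ∑ i ∈ s, frob (M i) := by
  classical
  induction s using Finset.induction_on with
  | empty => simp [frob_zero]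
  | insert a s ha ih =>
    rw [Finset.sum_insert ha, Finset.sum_insert ha]
    exact (frob_add_le _ _).trans (by gcongr)

theorem frob_conjTranspose (M : Matrix (Fin n) (Fin n) ℂ) : frob Mᴴ = frob M := by
  have h : frob Mᴴ ^ 2 = frob M ^ 2 := by
    rw [frob_sq, frob_sq, Finset.sum_comm]
    simp
  exact (pow_left_inj₀ (frob_nonneg _) (frob_nonneg _) two_ne_zero).1 h

theorem frob_one : frob (1 : Matrix (Fin n) (Fin n) ℂ) = √n := by
  have h : frob (1 : Matrix (Fin n) (Fin n) ℂ) ^ 2 = n := by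
    rw [frob_sq]
    simp [Matrix.one_apply, apply_ite]
  rw [← h, Real.sqrt_sq (frob_nonneg _)]

/-- The operator norm bound is applied to each column of `N`. -/
theorem frob_mul_le (M N : Matrix (Fin n) (Fin n) ℂ) : frob (M * N) ≤ ‖M‖ * frob N := by
  refine abs_le_of_sq_le_sq' ?_ (mul_nonneg (norm_nonneg _) (frob_nonneg _)) |>.2
  rw [mul_pow, frob_sq, frob_sq, Finset.mul_sum]
  refine Finset.sum_le_sum fun j _ => ?_
  have h := Matrix.l2_opNorm_mulVec M
    (WithLp.toLp 2 (fun i => N i j) : EuclideanSpace ℂ (Fin n))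
  have h2 := pow_le_pow_left₀ (norm_nonneg _) h 2
  rw [mul_pow, EuclideanSpace.norm_sq_eq, EuclideanSpace.norm_sq_eq] at h2
  simpa [Matrix.mulVec, Matrix.mul_apply, dotProduct] using h2

theorem frob_mul_le' (M N : Matrix (Fin n) (Fin n) ℂ) : frob (M * N) ≤ frob M * ‖N‖ := by
  rw [← frob_conjTranspose, Matrix.conjTranspose_mul, ← frob_conjTranspose M,
    ← Matrix.l2_opNorm_conjTranspose N, mul_comm]
  exact frob_mul_le _ _

theorem frob_le (M : Matrix (Fin n) (Fin n) ℂ) : frob M ≤ ‖M‖ * √n := by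
  have h := frob_mul_le M 1
  rwa [mul_one, frob_one] at h

/-- Cauchy–Schwarz for the Frobenius inner product. -/
theorem norm_trace_mul_le (M N : Matrix (Fin n) (Fin n) ℂ) :
    ‖(M * N).trace‖ ≤ frob M * frob N := by
  have h := norm_inner_le_norm (𝕜 := ℂ)
    (WithLp.toLp 2 (fun p : Fin n × Fin n => Mᴴ p.2 p.1) : EuclideanSpace ℂ (Fin n × Fin n))
    (WithLp.toLp 2 (fun p : Fin n × Fin n => Nᵀ p.1 p.2))
  have e1 : ‖(WithLp.toLp 2 (fun p : Fin n × Fin n => Mᴴ p.2 p.1) :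
      EuclideanSpace ℂ (Fin n × Fin n))‖ = frob M := by
    rw [EuclideanSpace.norm_eq, frob, EuclideanSpace.norm_eq]
    simp
  have e2 : ‖(WithLp.toLp 2 (fun p : Fin n × Fin n => Nᵀ p.1 p.2) :
      EuclideanSpace ℂ (Fin n × Fin n))‖ = frob N := by
    have : frob Nᵀ ^ 2 = frob N ^ 2 := by
      rw [frob_sq, frob_sq, Finset.sum_comm]
      simp
    exact (pow_left_inj₀ (frob_nonneg _) (frob_nonneg _) two_ne_zero).1 this
  rw [e1, e2] at h
  refine le_trans (le_of_eq ?_) h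
  congr 1
  simp [PiLp.inner_apply, Matrix.trace, Matrix.mul_apply, Fintype.sum_prod_type, mul_comm]

theorem norm_trace_le (M : Matrix (Fin n) (Fin n) ℂ) : ‖M.trace‖ ≤ n * ‖M‖ := by
  have h := norm_trace_mul_le M 1
  rw [mul_one, frob_one] at h
  refine h.trans ((mul_le_mul_of_nonneg_right (frob_le M) (Real.sqrt_nonneg _)).trans ?_)
  rw [mul_assoc, Real.mul_self_sqrt (Nat.cast_nonneg n), mul_comm]

/-- Only an inequality, since the identity is zero when `n = 0`. -/
theorem norm_one_matrix_le : ‖(1 : Matrix (Fin n) (Fin n) ℂ)‖ ≤ 1 := by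
  rw [Matrix.cstar_norm_def, map_one]
  exact ContinuousLinearMap.norm_id_le

theorem norm_matrix_pow_le (M : Matrix (Fin n) (Fin n) ℂ) (k : ℕ) : ‖M ^ k‖ ≤ ‖M‖ ^ k := by
  rcases Nat.eq_zero_or_pos k with rfl | hk
  · simpa using norm_one_matrix_le
  · exact norm_pow_le' M hk

end Frobenius

/-! ### Traces of matrix powers and their derivatives -/

section TracePolynomial

open scoped Matrix.Norms.L2Operator Matrix

variable {n : ℕ}

/-- The real-linear map `x ↦ scaledMatrix x` on Euclidean space. -/
noncomputable def scaledMatrixCLM (n : ℕ) :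
    EuclideanSpace ℝ (Fin n × Fin n) →L[ℝ] Matrix (Fin n) (Fin n) ℂ :=
  LinearMap.toContinuousLinearMap
    { toFun := fun x => scaledMatrix fun i j => x (i, j)
      map_add' := fun x y => by
        ext i j
        simp [scaledMatrix, mul_add]
      map_smul' := fun c x => by
        ext i j
        simp [scaledMatrix]
        ring }

theorem scaledMatrixCLM_apply (x : EuclideanSpace ℝ (Fin n × Fin n)) :
    scaledMatrixCLM n x = scaledMatrix fun i j => x (i, j) := rfl

/-- The source of the factor `1 / n` in the theorem: the Hessian takes two directions, each scaled
by `n ^ (-1/2)`. -/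
theorem frob_scaledMatrixCLM (x : EuclideanSpace ℝ (Fin n × Fin n)) :
    frob (scaledMatrixCLM n x) = (√n)⁻¹ * ‖x‖ := by
  have h0 : ((n : ℝ) ^ (-(1 / 2) : ℝ)) = (√n)⁻¹ := by
    rw [Real.rpow_neg (Nat.cast_nonneg n), Real.sqrt_eq_rpow]
  have h : frob (scaledMatrixCLM n x) ^ 2 = ((√n)⁻¹ * ‖x‖) ^ 2 := by
    rw [frob_sq, Finset.sum_comm, mul_pow, EuclideanSpace.norm_sq_eq, Fintype.sum_prod_type,
      Finset.mul_sum]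
    refine Finset.sum_congr rfl fun i _ => ?_
    rw [Finset.mul_sum]
    refine Finset.sum_congr rfl fun j _ => ?_
    rw [scaledMatrixCLM_apply, scaledMatrix, Matrix.of_apply, h0, Complex.norm_real, norm_mul,
      mul_pow, norm_inv, Real.norm_of_nonneg (Real.sqrt_nonneg _)]
  exact (pow_left_inj₀ (frob_nonneg _) (by positivity) two_ne_zero).1 h

/-- The real part of the trace. -/
noncomputable def reTrace (n : ℕ) : Matrix (Fin n) (Fin n) ℂ →L[ℝ] ℝ :=
  LinearMap.toContinuousLinearMap
    { toFun := fun M => M.trace.re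
      map_add' := fun M N => by simp
      map_smul' := fun c M => by simp }

theorem reTrace_apply (M : Matrix (Fin n) (Fin n) ℂ) : reTrace n M = M.trace.re := rfl

/-- The functional `v ↦ Re Tr (M A(v))`, where `A(v)` is the scaled matrix of `v`. -/
noncomputable def traceDual (n : ℕ) : Matrix (Fin n) (Fin n) ℂ →L[ℝ]
    StrongDual ℝ (EuclideanSpace ℝ (Fin n × Fin n)) :=
  LinearMap.toContinuousLinearMap
    { toFun := fun M => (reTrace n).comp
        ((ContinuousLinearMap.mul ℝ (Matrix (Fin n) (Fin n) ℂ) M).comp (scaledMatrixCLM n))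
      map_add' := fun M N => by ext v; simp
      map_smul' := fun c M => by ext v; simp }

theorem traceDual_apply (M : Matrix (Fin n) (Fin n) ℂ) (v : EuclideanSpace ℝ (Fin n × Fin n)) :
    traceDual n M v = (M * scaledMatrixCLM n v).trace.re := rfl

theorem norm_traceDual_le_frob (M : Matrix (Fin n) (Fin n) ℂ) :
    ‖traceDual n M‖ ≤ frob M * (√n)⁻¹ := by
  refine ContinuousLinearMap.opNorm_le_bound _ (mul_nonneg (frob_nonneg _) (by positivity))
    fun v => ?_
  rw [traceDual_apply, mul_assoc, ← frob_scaledMatrixCLM]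
  exact (Complex.abs_re_le_norm _).trans (norm_trace_mul_le _ _)

/-- The factor `√n` lost in passing from Frobenius to operator norm cancels the scaling, which
leaves the gradient bound free of `n`. -/
theorem norm_traceDual_le (hn : 0 < n) (M : Matrix (Fin n) (Fin n) ℂ) : ‖traceDual n M‖ ≤ ‖M‖ := by
  refine (norm_traceDual_le_frob M).trans ?_
  have : 0 < √(n : ℝ) := Real.sqrt_pos.2 (by exact_mod_cast hn)
  rw [← div_eq_mul_inv, div_le_iff₀ this]
  exact frob_le M

/-- The derivative of `M ↦ M ^ k`. -/
noncomputable def powDeriv (M : Matrix (Fin n) (Fin n) ℂ) (k : ℕ) :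
    Matrix (Fin n) (Fin n) ℂ →L[ℝ] Matrix (Fin n) (Fin n) ℂ :=
  ∑ i ∈ Finset.range k,
    ContinuousLinearMap.mulLeftRight ℝ (Matrix (Fin n) (Fin n) ℂ) (M ^ (k - 1 - i)) (M ^ i)

theorem powDeriv_apply (M V : Matrix (Fin n) (Fin n) ℂ) (k : ℕ) :
    powDeriv M k V = ∑ i ∈ Finset.range k, M ^ (k - 1 - i) * V * M ^ i := by
  simp [powDeriv]

theorem hasFDerivAt_matrix_pow (M : Matrix (Fin n) (Fin n) ℂ) (k : ℕ) :
    HasFDerivAt (fun M : Matrix (Fin n) (Fin n) ℂ => M ^ k) (powDeriv M k) M := by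
  refine (hasFDerivAt_pow' (𝕜 := ℝ) k (x := M)).congr_fderiv ?_
  ext V : 1
  rw [powDeriv_apply]
  simp [mul_assoc]

theorem continuous_powDeriv (k : ℕ) :
    Continuous fun M : Matrix (Fin n) (Fin n) ℂ => powDeriv M k := by
  unfold powDeriv
  fun_prop

/-- The outer powers are taken in operator norm and only `V` in Frobenius norm, so no dimensional
factor appears. -/
theorem frob_powDeriv_le (M V : Matrix (Fin n) (Fin n) ℂ) (k : ℕ) :
    frob (powDeriv M k V) ≤ k * ‖M‖ ^ (k - 1) * frob V := by
  rw [powDeriv_apply]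
  refine (frob_sum_le _ _).trans ?_
  calc ∑ i ∈ Finset.range k, frob (M ^ (k - 1 - i) * V * M ^ i)
      ≤ ∑ i ∈ Finset.range k, ‖M‖ ^ (k - 1) * frob V := by
        refine Finset.sum_le_sum fun i hi => ?_
        have hi' : k - 1 - i + i = k - 1 := by have := Finset.mem_range.1 hi; omega
        calc frob (M ^ (k - 1 - i) * V * M ^ i) ≤ frob (M ^ (k - 1 - i) * V) * ‖M ^ i‖ :=
              frob_mul_le' _ _
          _ ≤ (‖M ^ (k - 1 - i)‖ * frob V) * ‖M ^ i‖ := by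
              gcongr; exact frob_mul_le _ _
          _ ≤ (‖M‖ ^ (k - 1 - i) * frob V) * ‖M‖ ^ i := by
              have := frob_nonneg V
              gcongr <;> exact norm_matrix_pow_le _ _
          _ = ‖M‖ ^ (k - 1 - i + i) * frob V := by rw [pow_add]; ring
          _ = _ := by rw [hi']
    _ = _ := by simp [mul_assoc]

theorem norm_powDeriv_le (M : Matrix (Fin n) (Fin n) ℂ) (k : ℕ) :
    ‖powDeriv M k‖ ≤ k * ‖M‖ ^ (k - 1) := by
  refine ContinuousLinearMap.opNorm_le_bound _ (by positivity) fun V => ?_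
  rw [powDeriv_apply]
  refine (norm_sum_le _ _).trans ?_
  calc ∑ i ∈ Finset.range k, ‖M ^ (k - 1 - i) * V * M ^ i‖
      ≤ ∑ i ∈ Finset.range k, ‖M‖ ^ (k - 1) * ‖V‖ := by
        refine Finset.sum_le_sum fun i hi => ?_
        have hi' : k - 1 - i + i = k - 1 := by have := Finset.mem_range.1 hi; omega
        calc ‖M ^ (k - 1 - i) * V * M ^ i‖ ≤ (‖M ^ (k - 1 - i)‖ * ‖V‖) * ‖M ^ i‖ :=
              (norm_mul_le _ _).trans (by gcongr; exact norm_mul_le _ _)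
          _ ≤ (‖M‖ ^ (k - 1 - i) * ‖V‖) * ‖M‖ ^ i := by
              gcongr <;> exact norm_matrix_pow_le _ _
          _ = ‖M‖ ^ (k - 1 - i + i) * ‖V‖ := by rw [pow_add]; ring
          _ = _ := by rw [hi']
    _ = _ := by simp [mul_assoc]

/-- By cyclicity of the trace all `k` terms coincide. -/
theorem trace_powDeriv (M V : Matrix (Fin n) (Fin n) ℂ) (k : ℕ) :
    (powDeriv M k V).trace = k * (M ^ (k - 1) * V).trace := by
  rw [powDeriv_apply, Matrix.trace_sum]
  calc ∑ i ∈ Finset.range k, (M ^ (k - 1 - i) * V * M ^ i).trace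
      = ∑ i ∈ Finset.range k, (M ^ (k - 1) * V).trace := by
        refine Finset.sum_congr rfl fun i hi => ?_
        have hi' : i + (k - 1 - i) = k - 1 := by have := Finset.mem_range.1 hi; omega
        rw [Matrix.trace_mul_comm, ← mul_assoc, ← pow_add, hi']
    _ = _ := by simp

end TracePolynomial

/-! ### Sums and linear images of tame functions -/

section TameOperations

variable {E V W : Type*} [NormedAddCommGroup E] [NormedSpace ℝ E] [NormedAddCommGroup V]
  [NormedSpace ℝ V] [NormedAddCommGroup W] [NormedSpace ℝ W]

theorem PolyBound.sum {ι κ V V' : Type*} [SeminormedAddCommGroup V] [SeminormedAddCommGroup V']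
    {r : ι → V} {F : κ → ι → V'} (s : Finset κ) (h : ∀ k ∈ s, PolyBound r (F k)) :
    PolyBound r (fun i => ∑ k ∈ s, F k i) := by
  classical
  induction s using Finset.induction_on with
  | empty => simpa using PolyBound.const (r := r) (0 : V')
  | insert a s ha ih =>
    simp only [Finset.sum_insert ha]
    exact (h a (by simp)).add (ih fun k hk => h k (by simp [hk]))

theorem HasTameFDeriv.sum {κ : Type*} {g : κ → E → V} {g' : κ → E → E →L[ℝ] V} (s : Finset κ)
    (h : ∀ k ∈ s, HasTameFDeriv (g k) (g' k)) :
    HasTameFDeriv (fun x => ∑ k ∈ s, g k x) (fun x => ∑ k ∈ s, g' k x) where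
  hasFDerivAt x := HasFDerivAt.fun_sum fun k hk => (h k hk).hasFDerivAt x
  continuous_fderiv := continuous_finsetSum _ fun k hk => (h k hk).continuous_fderiv
  polyBound := PolyBound.sum s fun k hk => (h k hk).polyBound
  polyBound_fderiv := PolyBound.sum s fun k hk => (h k hk).polyBound_fderiv

theorem HasTameFDeriv.clm_comp {g : E → V} {g' : E → E →L[ℝ] V} (h : HasTameFDeriv g g')
    (L : V →L[ℝ] W) : HasTameFDeriv (fun x => L (g x)) (fun x => L.comp (g' x)) where
  hasFDerivAt x := L.hasFDerivAt.comp x (h.hasFDerivAt x)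
  continuous_fderiv := by
    have := h.continuous_fderiv
    fun_prop
  polyBound := (PolyBound.const L).clm_apply h.polyBound
  polyBound_fderiv := (PolyBound.const L).of_mul_le h.polyBound_fderiv fun _ => L.opNorm_comp_le _

end TameOperations

/-! ### Gradient and Hessian of trace polynomials -/

section TracePolynomial

open scoped Matrix.Norms.L2Operator Matrix

variable {n : ℕ}

theorem hasTameFDeriv_smul_pow (c : ℂ) (k : ℕ) :
    HasTameFDeriv (fun x => c • scaledMatrixCLM n x ^ k)
      (fun x => c • (powDeriv (scaledMatrixCLM n x) k).comp (scaledMatrixCLM n)) := by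
  have hA : PolyBound id fun x => ‖scaledMatrixCLM n x‖ :=
    ((PolyBound.const (scaledMatrixCLM n)).clm_apply (PolyBound.self id)).norm
  refine ⟨fun x => ?_, ?_, ?_, ?_⟩
  · exact ((hasFDerivAt_matrix_pow _ k).comp x (scaledMatrixCLM n).hasFDerivAt).const_smul c
  · have := continuous_powDeriv (n := n) k
    fun_prop
  · refine ((PolyBound.const ‖c‖).mul (hA.pow k)).of_le fun x => ?_
    rw [norm_smul]
    refine le_trans ?_ (le_abs_self _)
    gcongr
    exact norm_matrix_pow_le _ _
  · refine ((PolyBound.const ‖c‖).mul (((PolyBound.const (k : ℝ)).mul (hA.pow (k - 1))).mul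
      (PolyBound.const ‖scaledMatrixCLM n‖))).of_le fun x => ?_
    rw [norm_smul]
    refine le_trans ?_ (le_abs_self _)
    gcongr
    refine (ContinuousLinearMap.opNorm_comp_le _ _).trans ?_
    gcongr
    exact norm_powDeriv_le _ _

/-- `Re Tr p(A(x))` for the polynomial `p` with coefficients `c m`, `m < N`. -/
noncomputable def tracePoly (c : ℕ → ℂ) (N : ℕ) (x : EuclideanSpace ℝ (Fin n × Fin n)) : ℝ :=
  ∑ m ∈ Finset.range N, reTrace n (c m • scaledMatrixCLM n x ^ m)

/-- The gradient of `tracePoly`. -/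
noncomputable def tracePolyGrad (c : ℕ → ℂ) (N : ℕ) (x : EuclideanSpace ℝ (Fin n × Fin n)) :
    StrongDual ℝ (EuclideanSpace ℝ (Fin n × Fin n)) :=
  ∑ m ∈ Finset.range N, traceDual n ((c m * m) • scaledMatrixCLM n x ^ (m - 1))

/-- The Hessian of `tracePoly`. -/
noncomputable def tracePolyHess (c : ℕ → ℂ) (N : ℕ) (x : EuclideanSpace ℝ (Fin n × Fin n)) :
    EuclideanSpace ℝ (Fin n × Fin n) →L[ℝ] StrongDual ℝ (EuclideanSpace ℝ (Fin n × Fin n)) :=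
  ∑ m ∈ Finset.range N, (traceDual n).comp
    ((c m * m) • (powDeriv (scaledMatrixCLM n x) (m - 1)).comp (scaledMatrixCLM n))

theorem hasTameFDeriv_tracePoly (c : ℕ → ℂ) (N : ℕ) :
    HasTameFDeriv (tracePoly (n := n) c N) (tracePolyGrad c N) := by
  refine HasTameFDeriv.sum _ fun m _ => ?_
  have h := (hasTameFDeriv_smul_pow (n := n) (c m) m).clm_comp (reTrace n)
  convert h using 2 with x
  ext v
  simp only [traceDual_apply, ContinuousLinearMap.comp_apply, smul_apply, reTrace_apply,
    Matrix.trace_smul, trace_powDeriv, Matrix.smul_mul, smul_eq_mul, mul_assoc]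

theorem hasTameFDeriv_tracePolyGrad (c : ℕ → ℂ) (N : ℕ) :
    HasTameFDeriv (tracePolyGrad (n := n) c N) (tracePolyHess c N) :=
  HasTameFDeriv.sum _ fun m _ =>
    (hasTameFDeriv_smul_pow (n := n) (c m * m) (m - 1)).clm_comp (traceDual n)

theorem norm_tracePolyGrad_le (hn : 0 < n) (c : ℕ → ℂ) (N : ℕ)
    (x : EuclideanSpace ℝ (Fin n × Fin n)) :
    ‖tracePolyGrad c N x‖ ≤
      ∑ m ∈ Finset.range N, ‖c m‖ * m * ‖scaledMatrixCLM n x‖ ^ (m - 1) := by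
  refine (norm_sum_le _ _).trans (Finset.sum_le_sum fun m _ => ?_)
  refine (norm_traceDual_le hn _).trans ?_
  rw [norm_smul, norm_mul, Complex.norm_natCast]
  gcongr
  exact norm_matrix_pow_le _ _

set_option maxSynthPendingDepth 3 in
-- One factor `n ^ (-1/2)` comes from the direction `v`, the other from the dual pairing. Truncated
-- subtraction in the exponents is harmless, since the coefficient vanishes for `m ≤ 1`.
theorem norm_tracePolyHess_le (c : ℕ → ℂ) (N : ℕ)
    (x : EuclideanSpace ℝ (Fin n × Fin n)) :
    ‖tracePolyHess c N x‖ ≤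
      (∑ m ∈ Finset.range N,
        ‖c m‖ * m * (m - 1 : ℕ) * ‖scaledMatrixCLM n x‖ ^ (m - 1 - 1)) / n := by
  rw [Finset.sum_div]
  rw [tracePolyHess]
  refine (norm_sum_le (E := EuclideanSpace ℝ (Fin n × Fin n) →L[ℝ] StrongDual ℝ
    (EuclideanSpace ℝ (Fin n × Fin n))) _ _).trans (Finset.sum_le_sum fun m _ => ?_)
  refine ContinuousLinearMap.opNorm_le_bound _ (by positivity) fun v => ?_
  rw [ContinuousLinearMap.comp_apply]
  refine (norm_traceDual_le_frob _).trans ?_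
  rw [smul_apply, ContinuousLinearMap.comp_apply]
  have h1 : ∀ (d : ℂ) (M : Matrix (Fin n) (Fin n) ℂ), frob (d • M) = ‖d‖ * frob M := fun d M =>
    norm_smul d (WithLp.toLp 2 (fun p : Fin n × Fin n => M p.1 p.2) :
      EuclideanSpace ℂ (Fin n × Fin n))
  have h2 : (√(n : ℝ))⁻¹ * (√(n : ℝ))⁻¹ = (n : ℝ)⁻¹ := by
    rw [← mul_inv, Real.mul_self_sqrt (Nat.cast_nonneg n)]
  have h3 := frob_powDeriv_le (scaledMatrixCLM n x) (scaledMatrixCLM n v) (m - 1)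
  rw [frob_scaledMatrixCLM] at h3
  rw [h1, norm_mul, Complex.norm_natCast]
  calc ‖c m‖ * m * frob (powDeriv (scaledMatrixCLM n x) (m - 1) (scaledMatrixCLM n v)) * (√n)⁻¹
      ≤ ‖c m‖ * m * ((m - 1 : ℕ) * ‖scaledMatrixCLM n x‖ ^ (m - 1 - 1) * ((√n)⁻¹ * ‖v‖))
        * (√n)⁻¹ := by gcongr
    _ = ‖c m‖ * m * (m - 1 : ℕ) * ‖scaledMatrixCLM n x‖ ^ (m - 1 - 1) * ((√n)⁻¹ * (√n)⁻¹)
        * ‖v‖ := by ring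
    _ = _ := by rw [h2, div_eq_mul_inv]

end TracePolynomial

/-! ### The majorants of the derivatives -/

section Majorants

variable {f : ℂ → ℂ}

/-- The terms of the series at `2x` are bounded, which leaves a factor `2 ^ (-m)` to absorb `m ^ 2`.
-/
theorem summable_sq_mul_taylorCoeff (hf : Differentiable ℂ f) {x : ℝ} (hx : 0 < x) :
    Summable fun m : ℕ => (m : ℝ) ^ 2 * (‖taylorCoeff f m‖ * x ^ m) := by
  have h := (hasSum_taylorCoeff hf ((2 * x : ℝ) : ℂ)).summable.tendsto_atTop_zero.norm
  obtain ⟨C, hC⟩ := h.bddAbove_range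
  have hb : ∀ m : ℕ, ‖taylorCoeff f m‖ * (2 * x) ^ m ≤ C := fun m => by
    have := hC (Set.mem_range_self m)
    rwa [norm_mul, norm_pow, Complex.norm_real, Real.norm_of_nonneg (by positivity)] at this
  have hs := (summable_pow_mul_geometric_of_norm_lt_one 2 (r := (1 / 2 : ℝ))
    (by norm_num)).mul_left C
  refine hs.of_nonneg_of_le (fun m => by positivity) fun m => ?_
  calc (m : ℝ) ^ 2 * (‖taylorCoeff f m‖ * x ^ m)
      = (m : ℝ) ^ 2 * (‖taylorCoeff f m‖ * (2 * x) ^ m) * (1 / 2) ^ m := by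
        rw [mul_pow, one_div, inv_pow]; field_simp
    _ ≤ (m : ℝ) ^ 2 * C * (1 / 2) ^ m := by gcongr; exact hb m
    _ = _ := by ring

theorem summable_majorantOne (hf : Differentiable ℂ f) {x : ℝ} (hx : 0 ≤ x) :
    Summable fun k : ℕ => ((k : ℝ) + 1) * ‖taylorCoeff f (k + 1)‖ * x ^ k := by
  -- Comparison at `x + 1` keeps the radius positive when `x = 0` and makes its powers increasing.
  have h := (summable_nat_add_iff 1).2
    (summable_sq_mul_taylorCoeff hf (x := x + 1) (by linarith))
  refine h.of_nonneg_of_le (fun k => by positivity) fun k => ?_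
  push_cast
  rw [← mul_assoc]
  have h1 : x ^ k ≤ (x + 1) ^ (k + 1) :=
    (pow_le_pow_left₀ hx (by linarith) k).trans (pow_le_pow_right₀ (by linarith) (by omega))
  have h2 : ((k : ℝ) + 1) ≤ ((k : ℝ) + 1) ^ 2 :=
    le_self_pow₀ (by linarith [k.cast_nonneg (α := ℝ)]) two_ne_zero
  gcongr

theorem summable_majorantTwo (hf : Differentiable ℂ f) {x : ℝ} (hx : 0 ≤ x) :
    Summable fun k : ℕ => ((k : ℝ) + 2) * ((k : ℝ) + 1) * ‖taylorCoeff f (k + 2)‖ * x ^ k := by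
  have h := (summable_nat_add_iff 2).2
    (summable_sq_mul_taylorCoeff hf (x := x + 1) (by linarith))
  refine h.of_nonneg_of_le (fun k => by positivity) fun k => ?_
  push_cast
  rw [← mul_assoc]
  have h1 : x ^ k ≤ (x + 1) ^ (k + 2) :=
    (pow_le_pow_left₀ hx (by linarith) k).trans (pow_le_pow_right₀ (by linarith) (by omega))
  have h2 : ((k : ℝ) + 2) * ((k : ℝ) + 1) ≤ ((k : ℝ) + 2) ^ 2 := by
    rw [sq]; gcongr; norm_num
  gcongr

theorem sum_le_majorantOne (hf : Differentiable ℂ f) {x : ℝ} (hx : 0 ≤ x) (N : ℕ) :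
    ∑ m ∈ Finset.range N, ‖taylorCoeff f m‖ * m * x ^ (m - 1) ≤ majorantOne f x := by
  calc ∑ m ∈ Finset.range N, ‖taylorCoeff f m‖ * m * x ^ (m - 1)
      ≤ ∑ m ∈ Finset.range (N + 1), ‖taylorCoeff f m‖ * m * x ^ (m - 1) :=
        Finset.sum_le_sum_of_subset_of_nonneg (Finset.range_mono (by omega))
          fun _ _ _ => by positivity
    _ = ∑ k ∈ Finset.range N, ((k : ℝ) + 1) * ‖taylorCoeff f (k + 1)‖ * x ^ k := by
        rw [Finset.sum_range_succ']
        simp [mul_comm]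
    _ ≤ _ := (summable_majorantOne hf hx).sum_le_tsum _ fun _ _ => by positivity

theorem sum_le_majorantTwo (hf : Differentiable ℂ f) {x : ℝ} (hx : 0 ≤ x) (N : ℕ) :
    ∑ m ∈ Finset.range N, ‖taylorCoeff f m‖ * m * (m - 1 : ℕ) * x ^ (m - 1 - 1)
      ≤ majorantTwo f x := by
  calc ∑ m ∈ Finset.range N, ‖taylorCoeff f m‖ * m * (m - 1 : ℕ) * x ^ (m - 1 - 1)
      ≤ ∑ m ∈ Finset.range (N + 2), ‖taylorCoeff f m‖ * m * (m - 1 : ℕ) * x ^ (m - 1 - 1) :=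
        Finset.sum_le_sum_of_subset_of_nonneg (Finset.range_mono (by omega))
          fun _ _ _ => by positivity
    _ = ∑ k ∈ Finset.range N, ((k : ℝ) + 2) * ((k : ℝ) + 1) * ‖taylorCoeff f (k + 2)‖ * x ^ k := by
        rw [Finset.sum_range_succ', Finset.sum_range_succ']
        simp only [Nat.add_sub_cancel, Nat.cast_zero, mul_zero, zero_mul, add_zero, zero_add,
          Nat.sub_self]
        refine Finset.sum_congr rfl fun k _ => ?_
        push_cast
        ring
    _ ≤ _ := (summable_majorantTwo hf hx).sum_le_tsum _ fun _ _ => by positivity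

/-- Controls the statistic itself by `f₁`, so that the fourth moment of `f₁(λ)` suffices to dominate
all truncations. -/
theorem sum_le_add_mul_majorantOne (hf : Differentiable ℂ f) {x : ℝ} (hx : 0 ≤ x) (N : ℕ) :
    ∑ m ∈ Finset.range N, ‖taylorCoeff f m‖ * x ^ m ≤ ‖taylorCoeff f 0‖ + x * majorantOne f x := by
  calc ∑ m ∈ Finset.range N, ‖taylorCoeff f m‖ * x ^ m
      ≤ ∑ m ∈ Finset.range (N + 1), ‖taylorCoeff f m‖ * x ^ m :=
        Finset.sum_le_sum_of_subset_of_nonneg (Finset.range_mono (by omega))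
          fun _ _ _ => by positivity
    _ = ‖taylorCoeff f 0‖ + ∑ k ∈ Finset.range N, ‖taylorCoeff f (k + 1)‖ * x ^ (k + 1) := by
        rw [Finset.sum_range_succ', add_comm]; simp
    _ ≤ ‖taylorCoeff f 0‖ + x * ∑ k ∈ Finset.range N,
          ((k : ℝ) + 1) * ‖taylorCoeff f (k + 1)‖ * x ^ k := by
        rw [Finset.mul_sum]
        refine add_le_add le_rfl (Finset.sum_le_sum fun k _ => ?_)
        calc ‖taylorCoeff f (k + 1)‖ * x ^ (k + 1)
            = 1 * (‖taylorCoeff f (k + 1)‖ * x ^ (k + 1)) := by ring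
          _ ≤ ((k : ℝ) + 1) * (‖taylorCoeff f (k + 1)‖ * x ^ (k + 1)) := by
              gcongr; linarith [k.cast_nonneg (α := ℝ)]
          _ = _ := by ring
    _ ≤ _ := by
        gcongr
        exact (summable_majorantOne hf hx).sum_le_tsum _ fun _ _ => by positivity

/-- A vanishing sum of nonnegative terms has only zero terms, and `x > 0` does not kill any
coefficient. This and the analogue for `f₂` exclude products `0 · ∞` in the final bound. -/
theorem taylorCoeff_eq_zero_of_majorantOne_eq_zero (hf : Differentiable ℂ f) {x : ℝ} (hx : 0 < x)
    (h : majorantOne f x = 0) (k : ℕ) : taylorCoeff f (k + 1) = 0 := by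
  have hs := (summable_majorantOne hf hx.le).hasSum
  rw [← majorantOne, h] at hs
  rw [hasSum_zero_iff_of_nonneg] at hs
  swap
  · intro k
    positivity
  have h1 := congrFun hs k
  simp only [Pi.zero_apply, mul_eq_zero, pow_eq_zero_iff', hx.ne', false_and, or_false,
    norm_eq_zero] at h1
  exact h1.resolve_left (by positivity)

theorem taylorCoeff_eq_zero_of_majorantTwo_eq_zero (hf : Differentiable ℂ f) {x : ℝ} (hx : 0 < x)
    (h : majorantTwo f x = 0) (k : ℕ) : taylorCoeff f (k + 2) = 0 := by
  have hs := (summable_majorantTwo hf hx.le).hasSum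
  rw [← majorantTwo, h] at hs
  rw [hasSum_zero_iff_of_nonneg] at hs
  swap
  · intro k
    positivity
  have h1 := congrFun hs k
  simp only [Pi.zero_apply, mul_eq_zero, pow_eq_zero_iff', hx.ne', false_and, or_false,
    norm_eq_zero] at h1
  exact h1.resolve_left (by push Not; constructor <;> positivity)

theorem majorantTwo_eq_zero_of_majorantOne_eq_zero (hf : Differentiable ℂ f) {x : ℝ} (hx : 0 < x)
    (h : majorantOne f x = 0) (y : ℝ) : majorantTwo f y = 0 := by
  simp [majorantTwo, taylorCoeff_eq_zero_of_majorantOne_eq_zero hf hx h]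

theorem majorantOne_eq_of_majorantTwo_eq_zero (hf : Differentiable ℂ f) {x : ℝ} (hx : 0 < x)
    (h : majorantTwo f x = 0) (y : ℝ) : majorantOne f y = ‖taylorCoeff f 1‖ := by
  rw [majorantOne, tsum_eq_single 0]
  · simp
  · intro k hk
    obtain ⟨j, rfl⟩ := Nat.exists_eq_succ_of_ne_zero hk
    simp [taylorCoeff_eq_zero_of_majorantTwo_eq_zero hf hx h j]

theorem measurable_majorantOne_comp {α : Type*} [MeasurableSpace α] (hf : Differentiable ℂ f)
    {l : α → ℝ} (hl : Measurable l) (h0 : ∀ x, 0 ≤ l x) :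
    Measurable fun x => majorantOne f (l x) :=
  measurable_of_tendsto_metrizable (f := fun N x => ∑ k ∈ Finset.range N,
      ((k : ℝ) + 1) * ‖taylorCoeff f (k + 1)‖ * l x ^ k) (fun N => by fun_prop)
    (tendsto_pi_nhds.2 fun x => (summable_majorantOne hf (h0 x)).hasSum.tendsto_sum_nat)

theorem measurable_majorantTwo_comp {α : Type*} [MeasurableSpace α] (hf : Differentiable ℂ f)
    {l : α → ℝ} (hl : Measurable l) (h0 : ∀ x, 0 ≤ l x) :
    Measurable fun x => majorantTwo f (l x) :=
  measurable_of_tendsto_metrizable (f := fun N x => ∑ k ∈ Finset.range N,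
      ((k : ℝ) + 2) * ((k : ℝ) + 1) * ‖taylorCoeff f (k + 2)‖ * l x ^ k) (fun N => by fun_prop)
    (tendsto_pi_nhds.2 fun x => (summable_majorantTwo hf (h0 x)).hasSum.tendsto_sum_nat)

end Majorants

/-! ### The linear statistic as a limit of trace polynomials -/

section TraceStatistic

open scoped Matrix.Norms.L2Operator

variable {n : ℕ} {f : ℂ → ℂ}

/-- The linear statistic `Re Tr f(A(x))` of the scaled matrix of `x`. -/
noncomputable def traceStat (f : ℂ → ℂ) (x : EuclideanSpace ℝ (Fin n × Fin n)) : ℝ :=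
  (matrixFun f (scaledMatrixCLM n x)).trace.re

theorem tendsto_tracePoly (hf : Differentiable ℂ f) (x : EuclideanSpace ℝ (Fin n × Fin n)) :
    Filter.Tendsto (fun N => tracePoly (taylorCoeff f) N x) Filter.atTop
      (nhds (traceStat f x)) := by
  have hs : Summable fun m => taylorCoeff f m • scaledMatrixCLM n x ^ m := by
    have h := (hasSum_taylorCoeff hf ((‖scaledMatrixCLM n x‖ : ℝ) : ℂ)).summable.norm
    refine Summable.of_norm_bounded h fun m => ?_
    have e : ‖((‖scaledMatrixCLM n x‖ : ℝ) : ℂ) ^ m‖ = ‖scaledMatrixCLM n x‖ ^ m := by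
      rw [norm_pow, Complex.norm_real, norm_norm]
    rw [norm_smul, norm_mul, e]
    gcongr
    exact norm_matrix_pow_le _ _
  exact ((reTrace n).hasSum hs.hasSum).tendsto_sum_nat

/-- The bound is uniform in `N` and serves as the dominating function. -/
theorem abs_tracePoly_le (hf : Differentiable ℂ f) (N : ℕ)
    (x : EuclideanSpace ℝ (Fin n × Fin n)) :
    |tracePoly (taylorCoeff f) N x| ≤ n * (‖taylorCoeff f 0‖ +
      ‖scaledMatrixCLM n x‖ * majorantOne f ‖scaledMatrixCLM n x‖) := by
  refine le_trans ?_ (mul_le_mul_of_nonneg_left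
    (sum_le_add_mul_majorantOne hf (norm_nonneg _) N) (Nat.cast_nonneg n))
  rw [Finset.mul_sum]
  refine (Finset.abs_sum_le_sum_abs _ _).trans (Finset.sum_le_sum fun m _ => ?_)
  refine (Complex.abs_re_le_norm _).trans ((norm_trace_le _).trans ?_)
  rw [norm_smul]
  gcongr
  exact norm_matrix_pow_le _ _

theorem measurable_traceStat (hf : Differentiable ℂ f) : Measurable (traceStat (n := n) f) :=
  measurable_of_tendsto_metrizable
    (fun N => (hasTameFDeriv_tracePoly (taylorCoeff f) N).continuous.measurable)
    (tendsto_pi_nhds.2 fun x => tendsto_tracePoly hf x)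

end TraceStatistic

/-! ### Dominated convergence for functions of quadratic growth -/

section Limit

theorem tendsto_integral_comp_of_dominated_sq {α : Type*} [MeasurableSpace α] {ν : Measure α}
    [IsProbabilityMeasure ν] {g : ℕ → α → ℝ} {w D : α → ℝ} (hg : ∀ N, Measurable (g N))
    (hgD : ∀ N x, |g N x| ≤ D x) (hw : ∀ x, Filter.Tendsto (g · x) Filter.atTop (nhds (w x)))
    (hD : Integrable (fun x => D x ^ 2) ν) {Ψ : ℝ → ℝ} (hΨ : Continuous Ψ) {C : ℝ}
    (hC : ∀ y, |Ψ y| ≤ C * (1 + y ^ 2)) :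
    Integrable (fun x => Ψ (w x)) ν ∧
    Filter.Tendsto (fun N => ∫ x, Ψ (g N x) ∂ν) Filter.atTop (nhds (∫ x, Ψ (w x) ∂ν)) := by
  have hC0 : 0 ≤ C := by simpa using (abs_nonneg _).trans (hC 0)
  have hwm : Measurable w := measurable_of_tendsto_metrizable hg (tendsto_pi_nhds.2 hw)
  have hwD : ∀ x, |w x| ≤ D x := fun x =>
    le_of_tendsto (hw x).abs (Filter.Eventually.of_forall fun N => hgD N x)
  have hi : Integrable (fun x => C * (1 + D x ^ 2)) ν :=
    ((integrable_const (1 : ℝ)).add hD).const_mul C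
  have hb : ∀ {y d : ℝ}, |y| ≤ d → |Ψ y| ≤ C * (1 + d ^ 2) := fun {y d} h => by
    refine (hC y).trans ?_
    have : y ^ 2 ≤ d ^ 2 := sq_le_sq' (abs_le.1 h).1 (abs_le.1 h).2
    gcongr
  refine ⟨hi.mono' (hΨ.measurable.comp hwm).aestronglyMeasurable
    (Filter.Eventually.of_forall fun x => hb (hwD x)), ?_⟩
  exact tendsto_integral_of_dominated_convergence _
    (fun N => (hΨ.measurable.comp (hg N)).aestronglyMeasurable) hi
    (fun N => Filter.Eventually.of_forall fun x => hb (hgD N x))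
    (Filter.Eventually.of_forall fun x => (hΨ.tendsto _).comp (hw x))

end Limit

/-! ### The approximate Stein identity for the linear statistic -/

section TraceStein

open scoped Matrix.Norms.L2Operator

variable {n : ℕ} {f : ℂ → ℂ} {μ : Measure (EuclideanSpace ℝ (Fin n × Fin n))} [IsGaussian μ]

theorem measurable_norm_scaledMatrixCLM :
    Measurable fun x : EuclideanSpace ℝ (Fin n × Fin n) => ‖scaledMatrixCLM n x‖ :=
  (scaledMatrixCLM n).continuous.norm.measurable

/-- From `(c + pq)² ≤ 2c² + p⁴ + q⁴`: the norm of a Gaussian matrix has a fourth moment, and that of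
`f₁(λ)` is assumed. -/
theorem integrable_sq_traceStat_bound (hf : Differentiable ℂ f)
    (ha : Integrable (fun x => majorantOne f ‖scaledMatrixCLM n x‖ ^ 4) μ) :
    Integrable (fun x => (n * (‖taylorCoeff f 0‖ +
      ‖scaledMatrixCLM n x‖ * majorantOne f ‖scaledMatrixCLM n x‖) : ℝ) ^ 2) μ := by
  have hm : Measurable fun x => majorantOne f ‖scaledMatrixCLM n x‖ :=
    measurable_majorantOne_comp hf measurable_norm_scaledMatrixCLM fun x => norm_nonneg _
  have hA : Integrable (fun x => ‖scaledMatrixCLM n x‖ ^ 4) μ :=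
    ((((PolyBound.const (scaledMatrixCLM n)).clm_apply (PolyBound.self id)).norm).pow 4).integrable
      μ (measurable_norm_scaledMatrixCLM.pow_const 4).aestronglyMeasurable
  have hi : Integrable (fun x => (n : ℝ) ^ 2 * (2 * ‖taylorCoeff f 0‖ ^ 2 +
      (‖scaledMatrixCLM n x‖ ^ 4 + majorantOne f ‖scaledMatrixCLM n x‖ ^ 4))) μ :=
    ((integrable_const _).add (hA.add ha)).const_mul _
  refine hi.mono' ((((measurable_norm_scaledMatrixCLM.mul hm).const_add _).const_mul _).pow_const
    2).aestronglyMeasurable (Filter.Eventually.of_forall fun x => ?_)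
  rw [Real.norm_of_nonneg (sq_nonneg _), mul_pow]
  gcongr
  set p := ‖scaledMatrixCLM n x‖
  set q := majorantOne f p
  nlinarith [sq_nonneg (p ^ 2 - q ^ 2), sq_nonneg (‖taylorCoeff f 0‖ - p * q)]

set_option maxSynthPendingDepth 3 in
-- The majorants bound gradient and Hessian uniformly in the truncation `N`. The slack `ε` supplies
-- the strictly positive constants that the second order inequality requires.
theorem tracePoly_approx_stein (hn : 0 < n) (hμ : μ[id] = 0) (hf : Differentiable ℂ f) {s a b : ℝ}
    (hs0 : 0 ≤ s) (hs : ∀ l : StrongDual ℝ (EuclideanSpace ℝ (Fin n × Fin n)),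
      uncenteredCovarianceBilinDual μ l l ≤ s * ‖l‖ ^ 2) (ha0 : 0 ≤ a) (hb0 : 0 ≤ b)
    (ha : Integrable (fun x => majorantOne f ‖scaledMatrixCLM n x‖ ^ 4) μ)
    (ha' : ∫ x, majorantOne f ‖scaledMatrixCLM n x‖ ^ 4 ∂μ ≤ a ^ 4)
    (hb : Integrable (fun x => majorantTwo f ‖scaledMatrixCLM n x‖ ^ 4) μ)
    (hb' : ∫ x, majorantTwo f ‖scaledMatrixCLM n x‖ ^ 4 ∂μ ≤ b ^ 4)
    {ε : ℝ} (hε : 0 < ε) (N : ℕ) {ψ ψ' : ℝ → ℝ} {M : ℝ} (hψ : ∀ x, HasDerivAt ψ (ψ' x) x)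
    (hψ' : Continuous ψ') (hM : ∀ x, |ψ' x| ≤ M) :
    |(∫ x, tracePoly (taylorCoeff f) N x *
      ψ (tracePoly (taylorCoeff f) N x) ∂μ - (∫ x, tracePoly (taylorCoeff f) N x ∂μ) *
        ∫ x, ψ (tracePoly (taylorCoeff f) N x) ∂μ) -
      (∫ x, ψ' (tracePoly (taylorCoeff f) N x) ∂μ) *
        (∫ x, tracePoly (taylorCoeff f) N x * tracePoly (taylorCoeff f) N x ∂μ -
          (∫ x, tracePoly (taylorCoeff f) N x ∂μ) * ∫ x, tracePoly (taylorCoeff f) N x ∂μ)|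
      ≤ M * (2 * √((s + ε) ^ 3) * ((a + ε) * (b / n + ε))) := by
  have hn' : (0 : ℝ) < n := by exact_mod_cast hn
  have hG := hasTameFDeriv_tracePoly (n := n) (taylorCoeff f)
  have hH := hasTameFDeriv_tracePolyGrad (n := n) (taylorCoeff f)
  refine gaussian_second_order_poincare hμ (hG N) (hH N) (by positivity)
    (fun l => (hs l).trans ?_) (by positivity) (by positivity) ?_ ?_ hψ hψ' hM
  · gcongr; linarith
  · refine (integral_mono_of_nonneg (Filter.Eventually.of_forall fun x => by
      simp only [Pi.zero_apply]; positivity) ha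
      (Filter.Eventually.of_forall fun x => ?_)).trans (ha'.trans ?_)
    · exact pow_le_pow_left₀ (norm_nonneg _) ((norm_tracePolyGrad_le hn _ N x).trans
        (sum_le_majorantOne hf (norm_nonneg _) N)) 4
    · gcongr; linarith
  · have hb2 : Integrable (fun x => (majorantTwo f ‖scaledMatrixCLM n x‖ / n) ^ 4) μ := by
      simp only [div_pow]
      exact hb.div_const _
    have h0 : ∀ x, 0 ≤ ‖tracePolyHess (n := n) (taylorCoeff f) N x‖ := fun x => norm_nonneg _
    have hle : ∀ x, ‖tracePolyHess (n := n) (taylorCoeff f) N x‖ ≤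
        majorantTwo f ‖scaledMatrixCLM n x‖ / n := fun x =>
      (norm_tracePolyHess_le _ N x).trans
        (div_le_div_of_nonneg_right (sum_le_majorantTwo hf (norm_nonneg _) N) hn'.le)
    refine (integral_mono_of_nonneg (Filter.Eventually.of_forall fun x => pow_nonneg (h0 x) 4) hb2
      (Filter.Eventually.of_forall fun x => pow_le_pow_left₀ (h0 x) (hle x) 4)).trans ?_
    · simp only [div_pow]
      rw [integral_div]
      calc _ ≤ b ^ 4 / (n : ℝ) ^ 4 := by gcongr
        _ = (b / n) ^ 4 := by rw [div_pow]
        _ ≤ _ := by gcongr; linarith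

/-- Every integrand grows at most quadratically in the statistic, because `ψ` grows linearly; hence
each converges as `N → ∞`, and then `ε → 0`. -/
theorem traceStat_approx_stein (hn : 0 < n) (hμ : μ[id] = 0) (hf : Differentiable ℂ f) {s a b : ℝ}
    (hs0 : 0 ≤ s) (hs : ∀ l : StrongDual ℝ (EuclideanSpace ℝ (Fin n × Fin n)),
      uncenteredCovarianceBilinDual μ l l ≤ s * ‖l‖ ^ 2) (ha0 : 0 ≤ a) (hb0 : 0 ≤ b)
    (ha : Integrable (fun x => majorantOne f ‖scaledMatrixCLM n x‖ ^ 4) μ)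
    (ha' : ∫ x, majorantOne f ‖scaledMatrixCLM n x‖ ^ 4 ∂μ ≤ a ^ 4)
    (hb : Integrable (fun x => majorantTwo f ‖scaledMatrixCLM n x‖ ^ 4) μ)
    (hb' : ∫ x, majorantTwo f ‖scaledMatrixCLM n x‖ ^ 4 ∂μ ≤ b ^ 4)
    {ψ ψ' : ℝ → ℝ} {M : ℝ} (hψ : ∀ x, HasDerivAt ψ (ψ' x) x) (hψ' : Continuous ψ')
    (hM : ∀ x, |ψ' x| ≤ M) :
    |(∫ x, traceStat f x * ψ (traceStat f x) ∂μ
        - (∫ x, traceStat f x ∂μ) * ∫ x, ψ (traceStat f x) ∂μ) -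
      (∫ x, ψ' (traceStat f x) ∂μ) *
        (∫ x, traceStat f x * traceStat f x ∂μ - (∫ x, traceStat f x ∂μ) * ∫ x, traceStat f x ∂μ)|
      ≤ M * (2 * √(s ^ 3) * (a * (b / n))) := by
  have hM0 : 0 ≤ M := (abs_nonneg _).trans (hM 0)
  have hψc : Continuous ψ := continuous_iff_continuousAt.2 fun x => (hψ x).continuousAt
  have hG := hasTameFDeriv_tracePoly (n := n) (taylorCoeff f)
  have hlim : ∀ (Ψ : ℝ → ℝ), Continuous Ψ → ∀ C : ℝ, (∀ y, |Ψ y| ≤ C * (1 + y ^ 2)) →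
      Filter.Tendsto (fun N => ∫ x, Ψ (tracePoly (taylorCoeff f) N x) ∂μ) Filter.atTop
        (nhds (∫ x, Ψ (traceStat f x) ∂μ)) := fun Ψ hΨ C hC =>
    (tendsto_integral_comp_of_dominated_sq (fun N => (hG N).continuous.measurable)
      (fun N x => abs_tracePoly_le hf N x) (fun x => tendsto_tracePoly hf x)
      (integrable_sq_traceStat_bound hf ha) hΨ hC).2
  have hψb := abs_le_of_hasDerivAt_of_abs_le hψ hM
  have hy : ∀ y : ℝ, |y| ≤ 1 + y ^ 2 := fun y => by
    rw [← sq_abs]; nlinarith [sq_nonneg (|y| - 1), abs_nonneg y]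
  have l1 := hlim (fun y => y) (by fun_prop) 1 (by simpa using hy)
  have l2 := hlim (fun y => y * y) (by fun_prop) 1 fun y => by
    rw [abs_mul_self]; nlinarith
  have l3 := hlim ψ' hψ' M fun y => (hM y).trans (by nlinarith [sq_nonneg y])
  have l4 := hlim ψ hψc (|ψ 0| + M) fun y => (hψb y).trans (by
    nlinarith [hy y, mul_le_mul_of_nonneg_left (hy y) hM0,
      mul_nonneg (abs_nonneg (ψ 0)) (sq_nonneg y)])
  have l5 := hlim (fun y => y * ψ y) (by fun_prop) (|ψ 0| + M) fun y => by
    rw [abs_mul]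
    refine (mul_le_mul_of_nonneg_left (hψb y) (abs_nonneg y)).trans ?_
    have h1 : |y| * |y| = y ^ 2 := by rw [← sq, sq_abs]
    nlinarith [mul_le_mul_of_nonneg_left (hy y) (abs_nonneg (ψ 0))]
  have hL := ((l5.sub (l1.mul l4)).sub (l3.mul (l2.sub (l1.mul l1)))).abs
  have hcont : Continuous fun ε : ℝ => M * (2 * √((s + ε) ^ 3) * ((a + ε) * (b / n + ε))) := by
    fun_prop
  have ht := (hcont.tendsto 0).mono_left (nhdsWithin_le_nhds (s := Set.Ioi 0))
  simp only [add_zero] at ht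
  refine ge_of_tendsto ht (Filter.eventually_of_mem self_mem_nhdsWithin fun ε hε => ?_)
  exact le_of_tendsto hL (Filter.Eventually.of_forall fun N =>
    tracePoly_approx_stein hn hμ hf hs0 hs ha0 hb0 ha ha' hb hb' hε N hψ hψ' hM)

theorem integrable_comp_traceStat (hf : Differentiable ℂ f)
    (ha : Integrable (fun x => majorantOne f ‖scaledMatrixCLM n x‖ ^ 4) μ) {Ψ : ℝ → ℝ}
    (hΨ : Continuous Ψ) {C : ℝ} (hC : ∀ y, |Ψ y| ≤ C * (1 + y ^ 2)) :
    Integrable (fun x => Ψ (traceStat f x)) μ :=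
  (tendsto_integral_comp_of_dominated_sq
    (fun N => (hasTameFDeriv_tracePoly (taylorCoeff f) N).continuous.measurable)
    (fun N x => abs_tracePoly_le hf N x) (fun x => tendsto_tracePoly hf x)
    (integrable_sq_traceStat_bound hf ha) hΨ hC).1

theorem tvDist_map_traceStat_le (hn : 0 < n) (hμ : μ[id] = 0) (hf : Differentiable ℂ f) {s a b : ℝ}
    (hs0 : 0 ≤ s) (hs : ∀ l : StrongDual ℝ (EuclideanSpace ℝ (Fin n × Fin n)),
      uncenteredCovarianceBilinDual μ l l ≤ s * ‖l‖ ^ 2) (ha0 : 0 ≤ a) (hb0 : 0 ≤ b)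
    (ha : Integrable (fun x => majorantOne f ‖scaledMatrixCLM n x‖ ^ 4) μ)
    (ha' : ∫ x, majorantOne f ‖scaledMatrixCLM n x‖ ^ 4 ∂μ ≤ a ^ 4)
    (hb : Integrable (fun x => majorantTwo f ‖scaledMatrixCLM n x‖ ^ 4) μ)
    (hb' : ∫ x, majorantTwo f ‖scaledMatrixCLM n x‖ ^ 4 ∂μ ≤ b ^ 4)
    (hvar : 0 < variance (traceStat f) μ) :
    tvDist (μ.map (traceStat f))
        (gaussianReal (∫ x, traceStat f x ∂μ) (variance (traceStat f) μ).toNNReal) ≤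
      ENNReal.ofReal (2 / variance (traceStat f) μ * (2 * √(s ^ 3) * (a * (b / n)))) := by
  have hwm : Measurable (traceStat (n := n) f) := measurable_traceStat hf
  have : IsProbabilityMeasure (μ.map (traceStat f)) :=
    Measure.isProbabilityMeasure_map hwm.aemeasurable
  set m := ∫ x, traceStat f x ∂μ with hm
  have hy : ∀ y : ℝ, |y| ≤ 1 + y ^ 2 := fun y => by
    rw [← sq_abs]; nlinarith [sq_nonneg (|y| - 1), abs_nonneg y]
  have i1 : Integrable (traceStat f) μ :=
    integrable_comp_traceStat hf ha (Ψ := fun y => y) (by fun_prop) (C := 1) (by simpa using hy)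
  have i2 : Integrable (fun x => traceStat f x * traceStat f x) μ :=
    integrable_comp_traceStat hf ha (Ψ := fun y => y * y) (by fun_prop) (C := 1) fun y => by
      rw [abs_mul_self]; nlinarith
  have hv : variance (traceStat f) μ = ∫ x, traceStat f x * traceStat f x ∂μ - m * m := by
    have hL : MemLp (traceStat f) 2 μ := by
      rw [memLp_two_iff_integrable_sq hwm.aestronglyMeasurable]
      simpa only [sq] using i2
    rw [variance_eq_sub hL]
    simp only [sq, Pi.mul_apply, hm]
  have hvr : ((variance (traceStat f) μ).toNNReal : ℝ) = variance (traceStat f) μ :=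
    Real.coe_toNNReal _ hvar.le
  have h := tvDist_gaussianReal_le (ν := μ.map (traceStat f)) m
    (v := (variance (traceStat f) μ).toNNReal) (by simpa using hvar)
    (K := 2 * √(s ^ 3) * (a * (b / n))) fun ψ ψ' M hψ hψ' hM => by
      have hM0 : 0 ≤ M := (abs_nonneg _).trans (hM 0)
      have hψc : Continuous ψ := continuous_iff_continuousAt.2 fun x => (hψ x).continuousAt
      have hψb := abs_le_of_hasDerivAt_of_abs_le hψ hM
      have j1 : Integrable (fun x => ψ (traceStat f x)) μ :=
        integrable_comp_traceStat hf ha hψc (C := |ψ 0| + M) fun y => (hψb y).trans (by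
          nlinarith [hy y, mul_le_mul_of_nonneg_left (hy y) hM0,
            mul_nonneg (abs_nonneg (ψ 0)) (sq_nonneg y)])
      have j2 : Integrable (fun x => traceStat f x * ψ (traceStat f x)) μ :=
        integrable_comp_traceStat hf ha (Ψ := fun y => y * ψ y) (by fun_prop) (C := |ψ 0| + M)
          fun y => by
            rw [abs_mul]
            refine (mul_le_mul_of_nonneg_left (hψb y) (abs_nonneg y)).trans ?_
            have h1 : |y| * |y| = y ^ 2 := by rw [← sq, sq_abs]
            nlinarith [mul_le_mul_of_nonneg_left (hy y) (abs_nonneg (ψ 0))]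
      have j3 : Integrable (fun x => (traceStat f x - m) * ψ (traceStat f x)) μ := by
        simp only [sub_mul]
        exact j2.sub (j1.const_mul m)
      have hc : Continuous fun y => (y - m) * ψ y := by fun_prop
      refine ⟨(integrable_map_measure hc.aestronglyMeasurable hwm.aemeasurable).2 j3, ?_⟩
      rw [integral_map hwm.aemeasurable hc.aestronglyMeasurable,
        integral_map hwm.aemeasurable hψ'.aestronglyMeasurable, hvr, hv]
      have e : ∫ x, (traceStat f x - m) * ψ (traceStat f x) ∂μ =
          ∫ x, traceStat f x * ψ (traceStat f x) ∂μ - m * ∫ x, ψ (traceStat f x) ∂μ := by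
        simp only [sub_mul]
        rw [integral_sub j2 (j1.const_mul m), integral_const_mul]
      rw [e, mul_comm (_ - m * m)]
      exact traceStat_approx_stein hn hμ hf hs0 hs ha0 hb0 ha ha' hb hb' hψ hψ' hM
  rwa [hvr] at h

end TraceStein

/-! ### Degenerate cases and the bound in extended reals -/

section TraceStatBound

open scoped Matrix.Norms.L2Operator

variable {n : ℕ} {f : ℂ → ℂ} {μ : Measure (EuclideanSpace ℝ (Fin n × Fin n))} [IsGaussian μ]

theorem tvDist_self {E : Type*} [MeasurableSpace E] (μ : Measure E) : tvDist μ μ = 0 := by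
  simp [tvDist]

theorem variance_eq_zero_of_ae_eq_const {Ω : Type*} [MeasurableSpace Ω] {P : Measure Ω}
    [IsProbabilityMeasure P] {W : Ω → ℝ} {c : ℝ} (h : ∀ᵐ ω ∂P, W ω = c) : variance W P = 0 := by
  rw [variance_congr h, variance_eq_integral aemeasurable_const]
  simp

theorem integrable_pow_four_of_eLpNorm_ne_top {α : Type*} [MeasurableSpace α] {ν : Measure α}
    {u : α → ℝ} (hu : Measurable u) (h : eLpNorm u 4 ν ≠ ∞) :
    Integrable (fun x => u x ^ 4) ν ∧ ∫ x, u x ^ 4 ∂ν = (eLpNorm u 4 ν).toReal ^ 4 := by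
  have hL : MemLp u 4 ν := ⟨hu.aestronglyMeasurable, h.lt_top⟩
  have hi : Integrable (fun x => ‖u x‖ ^ 4) ν := hL.integrable_norm_pow (by norm_num)
  have he : ∀ x, ‖u x‖ ^ 4 = u x ^ 4 := fun x => by
    rw [Real.norm_eq_abs, Even.pow_abs (by decide)]
  simp only [he] at hi
  refine ⟨hi, ?_⟩
  rw [hL.eLpNorm_eq_integral_rpow_norm (by norm_num) (by norm_num)]
  have h4 : (4 : ℝ≥0∞).toReal = (4 : ℕ) := by norm_num
  have h0 : 0 ≤ ∫ x, u x ^ 4 ∂ν := integral_nonneg fun x => by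
    simp only [Pi.zero_apply]; exact Even.pow_nonneg (by decide) _
  simp only [h4, Real.rpow_natCast, he]
  rw [ENNReal.toReal_ofReal (by positivity), Real.rpow_inv_natCast_pow h0 (by norm_num)]

/-- If the matrix were almost surely zero, the statistic would be constant. The point found is where
a majorant vanishing almost surely forces coefficients to vanish. -/
theorem exists_norm_pos_of_variance_pos (hvar : 0 < variance (traceStat (n := n) f) μ)
    {p : EuclideanSpace ℝ (Fin n × Fin n) → Prop} (hp : ∀ᵐ x ∂μ, p x) :
    ∃ x, 0 < ‖scaledMatrixCLM n x‖ ∧ p x := by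
  by_contra hcon
  push Not at hcon
  refine hvar.ne' (variance_eq_zero_of_ae_eq_const (c := traceStat (n := n) f 0) ?_)
  filter_upwards [hp] with x hx
  have h0 : scaledMatrixCLM n x = 0 := by
    by_contra h
    exact hcon x (norm_pos_iff.2 h) hx
  rw [traceStat, traceStat, h0, map_zero]

/-- With `s = 0` every functional has zero variance, so the Gaussian measure is a Dirac mass. -/
theorem pos_of_variance_pos (hμ : μ[id] = 0) {s : ℝ} (hs0 : 0 ≤ s)
    (hs : ∀ l : StrongDual ℝ (EuclideanSpace ℝ (Fin n × Fin n)),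
      uncenteredCovarianceBilinDual μ l l ≤ s * ‖l‖ ^ 2)
    (hvar : 0 < variance (traceStat (n := n) f) μ) : 0 < s := by
  refine hs0.lt_of_ne fun h => hvar.ne' ?_
  have hd : μ = Measure.dirac (∫ x, x ∂μ) := by
    refine IsGaussian.eq_dirac_of_variance_eq_zero fun L => ?_
    have h1 := hs L
    rw [← h, zero_mul] at h1
    have h2 := le_antisymm h1 (uncenteredCovarianceBilinDual_self_nonneg L)
    rw [uncenteredCovarianceBilinDual_eq] at h2
    rw [variance_eq_integral (by fun_prop), IsGaussian.integral_dual,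
      show ∫ x, x ∂μ = 0 from hμ, map_zero]
    simpa [sq] using h2
  rw [hd, variance_dirac]

theorem tvDist_map_traceStat_le_eLpNorm (hn : 0 < n) (hμ : μ[id] = 0) (hf : Differentiable ℂ f)
    {s : ℝ} (hs0 : 0 ≤ s) (hs : ∀ l : StrongDual ℝ (EuclideanSpace ℝ (Fin n × Fin n)),
      uncenteredCovarianceBilinDual μ l l ≤ s * ‖l‖ ^ 2) (hL : MemLp (traceStat f) 2 μ) :
    tvDist (μ.map (traceStat f))
        (gaussianReal (∫ x, traceStat f x ∂μ) (variance (traceStat f) μ).toNNReal) ≤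
      ENNReal.ofReal (2 * √5 * s ^ (3 / 2 : ℝ)) *
        eLpNorm (fun x => majorantOne f ‖scaledMatrixCLM n x‖) 4 μ *
        eLpNorm (fun x => majorantTwo f ‖scaledMatrixCLM n x‖) 4 μ /
        ENNReal.ofReal (variance (traceStat f) μ * n) := by
  have hn' : (0 : ℝ) < n := by exact_mod_cast hn
  rcases (variance_nonneg (traceStat f) μ).eq_or_lt' with h0 | hvar
  -- With zero variance both laws are the same Dirac mass.
  · have hae := ae_eq_integral_of_variance_eq_zero hL h0
    rw [h0, Real.toNNReal_zero, gaussianReal_zero_var, Measure.map_congr hae, Measure.map_const,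
      measure_univ, one_smul, tvDist_self]
    exact zero_le
  have hs1 := pos_of_variance_pos hμ hs0 hs hvar
  set a := eLpNorm (fun x => majorantOne f ‖scaledMatrixCLM n x‖) 4 μ with ha
  set b := eLpNorm (fun x => majorantTwo f ‖scaledMatrixCLM n x‖) 4 μ with hb
  have m1 : Measurable fun x => majorantOne f ‖scaledMatrixCLM n x‖ :=
    measurable_majorantOne_comp hf measurable_norm_scaledMatrixCLM fun x => norm_nonneg _
  have m2 : Measurable fun x => majorantTwo f ‖scaledMatrixCLM n x‖ :=
    measurable_majorantTwo_comp hf measurable_norm_scaledMatrixCLM fun x => norm_nonneg _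
  have hab : ∀ c : ℝ≥0∞, c = ∞ → c / ENNReal.ofReal (variance (traceStat f) μ * n) = ∞ :=
    fun c hc => by rw [hc]; exact ENNReal.top_div_of_ne_top ENNReal.ofReal_ne_top
  have hc0 : ENNReal.ofReal (2 * √5 * s ^ (3 / 2 : ℝ)) ≠ 0 :=
    (ENNReal.ofReal_pos.2 (by positivity)).ne'
  by_cases hatop : a = ∞
  -- If `b` were `0`, then `f` would be affine and `f₁` constant, contradicting `a = ∞`. So the
  -- right side is infinite.
  · have hb0 : b ≠ 0 := fun hb0 => by
      rw [hb, eLpNorm_eq_zero_iff m2.aestronglyMeasurable (by norm_num)] at hb0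
      obtain ⟨x, hx, hx0⟩ := exists_norm_pos_of_variance_pos hvar hb0
      refine absurd hatop (ne_of_lt ?_)
      simp only [ha, majorantOne_eq_of_majorantTwo_eq_zero hf hx hx0]
      exact (memLp_const _).eLpNorm_lt_top
    rw [hab _ (by rw [hatop, ENNReal.mul_top hc0, ENNReal.top_mul hb0])]
    exact le_top
  by_cases hbtop : b = ∞
  -- If `a` were `0`, then `f` would be constant and `f₂` zero, contradicting `b = ∞`.
  · have ha0 : a ≠ 0 := fun ha0 => by
      rw [ha, eLpNorm_eq_zero_iff m1.aestronglyMeasurable (by norm_num)] at ha0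
      obtain ⟨x, hx, hx0⟩ := exists_norm_pos_of_variance_pos hvar ha0
      refine absurd hbtop (ne_of_lt ?_)
      simp only [hb, majorantTwo_eq_zero_of_majorantOne_eq_zero hf hx hx0]
      exact (memLp_const _).eLpNorm_lt_top
    rw [hab _ (by rw [hbtop, ENNReal.mul_top (mul_ne_zero hc0 ha0)])]
    exact le_top
  obtain ⟨i1, e1⟩ := integrable_pow_four_of_eLpNorm_ne_top m1 hatop
  obtain ⟨i2, e2⟩ := integrable_pow_four_of_eLpNorm_ne_top m2 hbtop
  refine (tvDist_map_traceStat_le hn hμ hf hs0 hs ENNReal.toReal_nonneg ENNReal.toReal_nonneg i1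
    e1.le i2 e2.le hvar).trans ?_
  rw [← ENNReal.ofReal_toReal hatop, ← ENNReal.ofReal_toReal hbtop,
    ← ENNReal.ofReal_mul (by positivity), ← ENNReal.ofReal_mul (by positivity),
    ← ENNReal.ofReal_div_of_pos (by positivity)]
  refine ENNReal.ofReal_le_ofReal ?_
  have hsq : √(s ^ 3) = s ^ (3 / 2 : ℝ) := by
    rw [Real.sqrt_eq_rpow, ← Real.rpow_natCast, ← Real.rpow_mul hs0]
    norm_num
  -- The argument gives the constant `2 * 2`, which is weakened to `2 * √5`.
  have h5 : (2 : ℝ) ≤ √5 := Real.le_sqrt_of_sq_le (by norm_num)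
  have hX : (0 : ℝ) ≤ s ^ (3 / 2 : ℝ) * (a.toReal * b.toReal) /
    (variance (traceStat f) μ * n) := by positivity
  calc _ = 2 * 2 * (s ^ (3 / 2 : ℝ) * (a.toReal * b.toReal) /
        (variance (traceStat f) μ * n)) := by
        rw [hsq]; field_simp; ring
    _ ≤ 2 * √5 * (s ^ (3 / 2 : ℝ) * (a.toReal * b.toReal) /
        (variance (traceStat f) μ * n)) := by gcongr
    _ = _ := by ring

end TraceStatBound

/-! ### The covariance form and the norm of the covariance matrix -/

section Covariance

/-- By Riesz `l` is the inner product with a vector `v` of the same norm, and the form at `l` is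
`⟨v, S v⟩`. -/
theorem uncenteredCovarianceBilinDual_le_opNorm {ι : Type*} [Fintype ι] [DecidableEq ι]
    {μ : Measure (EuclideanSpace ℝ ι)} [IsGaussian μ] {S : Matrix ι ι ℝ}
    (hS : ∀ p q, S p q = ∫ x, x p * x q ∂μ) (l : StrongDual ℝ (EuclideanSpace ℝ ι)) :
    uncenteredCovarianceBilinDual μ l l ≤ opNorm S * ‖l‖ ^ 2 := by
  obtain ⟨v, rfl⟩ := (InnerProductSpace.toDual ℝ (EuclideanSpace ℝ ι)).surjective l
  have hl : InnerProductSpace.toDual ℝ (EuclideanSpace ℝ ι) v =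
      ∑ p, v p • (EuclideanSpace.proj p : EuclideanSpace ℝ ι →L[ℝ] ℝ) := by
    ext x
    simp [PiLp.inner_apply, mul_comm]
  have e : uncenteredCovarianceBilinDual μ (InnerProductSpace.toDual ℝ (EuclideanSpace ℝ ι) v)
      (InnerProductSpace.toDual ℝ (EuclideanSpace ℝ ι) v) =
      inner ℝ v (Matrix.toEuclideanCLM (𝕜 := ℝ) S v) := by
    have hproj : ∀ (p : ι) (x : EuclideanSpace ℝ ι), EuclideanSpace.proj (𝕜 := ℝ) p x = x p :=
      fun _ _ => rfl
    rw [hl, Matrix.inner_toEuclideanCLM]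
    simp only [map_sum, map_smul, sum_apply, smul_apply, smul_eq_mul, dotProduct, Matrix.mulVec,
      uncenteredCovarianceBilinDual_eq, hproj, hS, Finset.mul_sum]
    rw [Finset.sum_comm]
    refine Finset.sum_congr rfl fun p _ => Finset.sum_congr rfl fun q _ => ?_
    ring
  rw [e, LinearIsometryEquiv.norm_map, sq, mul_left_comm]
  refine (real_inner_le_norm _ _).trans ?_
  gcongr
  rw [mul_comm, opNorm, mul_comm]
  exact ContinuousLinearMap.le_opNorm _ _

end Covariance

theorem mainTheorem7
    {Ω Ω' : Type*} [MeasurableSpace Ω] [MeasurableSpace Ω']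
    (P : Measure Ω) [IsProbabilityMeasure P]
    (P' : Measure Ω') [IsProbabilityMeasure P']
    (n : ℕ) (hn : 0 < n)
    (X : Fin n → Fin n → Ω → ℝ)
    (hX : HasGaussianLaw (fun ω (p : Fin n × Fin n) => X p.1 p.2 ω) P)
    (hmean : ∀ i j, ∫ ω, X i j ω ∂P = 0)
    (S : Matrix (Fin n × Fin n) (Fin n × Fin n) ℝ)
    (hS : ∀ p q, S p q = covariance (X p.1 p.2) (X q.1 q.2) P)
    (A : Ω → Matrix (Fin n) (Fin n) ℂ)
    (hA : ∀ ω, A ω = scaledMatrix (fun i j => X i j ω))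
    (f : ℂ → ℂ) (hf : Differentiable ℂ f)
    (a b : ℝ≥0∞)
    (ha : a = eLpNorm (fun ω => majorantOne f (opNorm (A ω))) 4 P)
    (hb : b = eLpNorm (fun ω => majorantTwo f (opNorm (A ω))) 4 P)
    (W : Ω → ℝ) (hW : ∀ ω, W ω = (matrixFun f (A ω)).trace.re)
    (hW4 : MemLp W 4 P)
    (Z : Ω' → ℝ)
    (hZ : HasLaw Z (gaussianReal (∫ ω, W ω ∂P) (variance W P).toNNReal) P') :
    tvDist (P.map W) (P'.map Z) ≤
      ENNReal.ofReal (2 * √5 * opNorm S ^ (3 / 2 : ℝ)) * a * b /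
        ENNReal.ofReal (variance W P * n) := by
  -- All quantities depend only on the law of the entries, so everything is transferred to that
  -- Gaussian measure on Euclidean space.
  set Y : Ω → EuclideanSpace ℝ (Fin n × Fin n) := fun ω => WithLp.toLp 2 fun p => X p.1 p.2 ω
    with hY
  have hYG : HasGaussianLaw Y P := hX.toLp_pi 2
  have hYm : AEMeasurable Y P := hYG.aemeasurable
  have : IsGaussian (P.map Y) := hYG.isGaussian_map
  have hAY : ∀ ω, A ω = scaledMatrixCLM n (Y ω) := fun ω => by
    rw [hA, scaledMatrixCLM_apply]
  have hWY : W = traceStat f ∘ Y := by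
    funext ω
    rw [hW, hAY]
    rfl
  have hwm : Measurable (traceStat (n := n) f) := measurable_traceStat hf
  -- `opNorm` unfolds to the operator norm used for matrices above, so the earlier lemmas apply as
  -- they are.
  have m1 : Measurable fun x => majorantOne f (opNorm (scaledMatrixCLM n x)) :=
    measurable_majorantOne_comp hf measurable_norm_scaledMatrixCLM fun x => norm_nonneg _
  have m2 : Measurable fun x => majorantTwo f (opNorm (scaledMatrixCLM n x)) :=
    measurable_majorantTwo_comp hf measurable_norm_scaledMatrixCLM fun x => norm_nonneg _
  have e1 : a = eLpNorm (fun x => majorantOne f (opNorm (scaledMatrixCLM n x))) 4 (P.map Y) := by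
    rw [ha, eLpNorm_map_measure m1.aestronglyMeasurable hYm]
    simp only [hAY, Function.comp_def]
  have e2 : b = eLpNorm (fun x => majorantTwo f (opNorm (scaledMatrixCLM n x))) 4 (P.map Y) := by
    rw [hb, eLpNorm_map_measure m2.aestronglyMeasurable hYm]
    simp only [hAY, Function.comp_def]
  have e3 : ∫ ω, W ω ∂P = ∫ x, traceStat f x ∂P.map Y := by
    rw [integral_map hYm hwm.aestronglyMeasurable, hWY]
    rfl
  have e4 : variance W P = variance (traceStat f) (P.map Y) := by
    rw [variance_map hwm.aemeasurable hYm, hWY]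
  have e5 : P.map W = (P.map Y).map (traceStat f) := by
    rw [AEMeasurable.map_map_of_aemeasurable hwm.aemeasurable hYm, hWY]
  have hL : MemLp (traceStat f) 2 (P.map Y) := by
    rw [memLp_map_measure_iff hwm.aestronglyMeasurable hYm, ← hWY]
    exact hW4.mono_exponent (by norm_num)
  have hcoord : ∀ p, ∫ x : EuclideanSpace ℝ (Fin n × Fin n), x p ∂P.map Y = 0 := fun p => by
    rw [integral_map hYm (by fun_prop)]
    exact hmean p.1 p.2
  have hμ : (P.map Y)[id] = 0 := by
    ext p
    have h := IsGaussian.integral_dual (μ := P.map Y)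
      (EuclideanSpace.proj p : EuclideanSpace ℝ (Fin n × Fin n) →L[ℝ] ℝ)
    exact h.symm.trans (hcoord p)
  have hSY : ∀ p q, S p q = ∫ x : EuclideanSpace ℝ (Fin n × Fin n), x p * x q ∂P.map Y := by
    intro p q
    rw [hS, covariance, integral_map hYm (by fun_prop), hmean, hmean]
    simp only [sub_zero]
    rfl
  rw [hZ.map_eq, e1, e2, e3, e4, e5]
  exact tvDist_map_traceStat_le_eLpNorm hn hμ hf (norm_nonneg _)
    (uncenteredCovarianceBilinDual_le_opNorm hSY) hL
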